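/- Write $\lg$ for $\log_2$. **Machine.** A BSP computer has $p$ processors and parameters $L,g\ge 0$. A superstep in which every processor performs at most $x$ basic steps and transmits or receives at most $h$ words (the maxima being attained) contributes $x$ to the computation time and $\max\{L,gh\}$ to the communication time of a program. Locally, sorting $m$ keys is charged $m\lg m$, merging $q$ sorted lists of total size $m$ is charged $m\lg q$, a binary search in a sorted list of length $m$ is charged $\lceil\lg(m+1)\rceil$, and other elementary operations are charged $O(1)$ each. **Algorithm** Sort\_Det\_BSP, for $n$ distinct keys from a linear order, evenly distributed (at most $\lceil n/p\rceil$ keys at each processor), with a parameter $\omega_n>0$; put $r=\lceil\omega_n\rceil$, $s=rp$, $x=\lceil\lceil n/p\rceil/s\rceil$. (1) Every processor sorts its keys, and takes as its sample the keys of rank $x,2x,\dots,sx$ of its sorted sequence, padded with a maximum key to length $sx$. (2) The $p$ sorted samples of size $s$ are sorted by Batcher's bitonic sorting network with $\lceil\lg p\rceil$ merges run on the $p$ blocks, comparators being replaced by merge-split operations (those involving a missing block of index $\ge p$ are idle). Here $d\ge1$ is a constant: the last $d$ levels of every bitonic merge, which act inside groups of $2^d$ consecutive processors, are performed jointly in one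 superstep (the members of a group exchange their blocks, and each merges them and keeps its part), and so are the first $d$ merges; every other level is one superstep. For $d=1$ this is one superstep for each level of the network. (3) The keys of rank $s,2s,\dots,(p-1)s$ of the sorted sample (the splitters), which are the last keys of the blocks of all processors but the last, are sent to all processors. Every processor partitions its sorted keys into $p$ subsequences by binary search of the splitters, and $p$ independent parallel-prefix operations on the sizes of the subsequences, performed in two supersteps (the $i$-th one by processor $i$, which receives the $p$ sizes and returns the results), determine the positions at which the subsequences are to be stored. (4) The $i$-th subsequence of every processor is sent to the $i$-th processor, and every processor merges the $p$ sorted sequences it receives. **Proposition.** For all integers $n,p$ with $2\le p\le n$ and every $\omega_n$ with $\omega_n=\Omega(1)$, $\omega_n=O(\lg n)$ and $p^2\omega_n^2\le n/\lg n$, put $$n_{\max}=\Bigl(1+\frac1{\lceil\omega_n\rceil}\Bigr)\frac np+\lceil\omega_n\rceil p .$$ Then, on every input, Sort\_Det\_BSP with any constant $d\ge1$ takes computation time at most $$\frac np\lg\frac np+n_{\max}\lg p+O\bigl(p+\omega_n\,p\lg^2p\bigr),$$ and its communication time is at most $$g\,n_{\max}+\frac{L\lg^2p}{2}+O\bigl(L+g\,\omega_n\,p\lg^2p\bigr)\qquad\text{if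 } d\ge3,$$ $$g\,n_{\max}+\frac{L\,(\lceil\lg p\rceil^2+\lceil\lg p\rceil)}{2}+O\bigl(L+g\,\omega_n\,p\lg^2p\bigr)\qquad\text{if } d=1 .$$ The implied constants depend only on $d$ and on the constants in $\omega_n=\Omega(1)$ and $\omega_n=O(\lg n)$; they do not depend on $n$, $p$, $L$, $g$ or the input. -/

import Mathlib

namespace BSP

/-- The binary logarithm. -/
noncomputable def lg (x : ℝ) : ℝ := Real.logb 2 x

/-! ### Charging policy for local operations -/

/-- A value computed locally by one processor, with the number of basic steps charged for it. -/
structure Charged (β : Type*) where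
  val : β
  cost : ℝ

section Local

variable {κ : Type*} [LinearOrder κ]

/-- Sequential sorting of `m` keys, charged `m lg m`. -/
noncomputable def sortSeq (l : List κ) : Charged (List κ) :=
  ⟨l.mergeSort (fun a b => decide (a ≤ b)), l.length * lg l.length⟩

/-- Sequential multi-way merging of `q` sorted lists of total size `m`, charged `m lg q`. -/
noncomputable def mergeSeq (ls : List (List κ)) : Charged (List κ) :=
  ⟨ls.foldr (fun a b => List.merge a b (fun u v => decide (u ≤ v))) [],
    ls.flatten.length * lg ls.length⟩

/-- Binary search in a sorted list of length `m`: the number of its entries that are at most `a`,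
charged `⌈lg (m + 1)⌉`. -/
def searchSeq (l : List κ) (a : κ) : Charged ℕ :=
  ⟨l.countP (fun b => decide (b ≤ a)), (Nat.clog 2 (l.length + 1) : ℕ)⟩

end Local

/-! ### The bulk-synchronous parallel machine -/

/-- A superstep of a `p`-processor machine whose processors have local memories of type `M` and
exchange words of type `W`. Every processor `k` transmits to every processor `j` a list of words
`send k m j` out of its local memory `m`; after the barrier it performs the local computation `work`
on its own memory and on the words it has received (the list from `j` being `inbox j`). -/
structure Superstep (p : ℕ) (M W : Type*) where
  send : Fin p → M → Fin p → List W
  work : Fin p → M → (Fin p → List W) → Charged M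

namespace Superstep

variable {p : ℕ} {M W : Type*}

/-- The local computation of processor `k`, when the memories are `m` before the superstep. -/
def exec (S : Superstep p M W) (m : Fin p → M) (k : Fin p) : Charged M :=
  S.work k (m k) (fun j => S.send j (m j) k)

/-- The memories after the superstep. -/
def run (S : Superstep p M W) (m : Fin p → M) : Fin p → M := fun k => (S.exec m k).val

/-- The maximum number `x` of basic steps performed by any processor. -/
noncomputable def x (S : Superstep p M W) (m : Fin p → M) : ℝ := ⨆ k, (S.exec m k).cost

/-- The maximum number `h` of words transmitted or received by any processor. -/
def h (S : Superstep p M W) (m : Fin p → M) : ℕ :=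
  Finset.univ.sup fun k =>
    max (∑ j, (S.send k (m k) j).length) (∑ j, (S.send j (m j) k).length)

end Superstep

/-- Computation time of a program (a list of supersteps) from initial memories `m`:
the sum of `x` over its supersteps. -/
noncomputable def compTime {p : ℕ} {M W : Type*} :
    List (Superstep p M W) → (Fin p → M) → ℝ
  | [], _ => 0
  | S :: Ss, m => S.x m + compTime Ss (S.run m)

/-- Communication (and synchronization) time of a program from initial memories `m`:
the sum of `max {L, g h}` over its supersteps. -/
noncomputable def commTime (L g : ℝ) {p : ℕ} {M W : Type*} :
    List (Superstep p M W) → (Fin p → M) → ℝ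
  | [], _ => 0
  | S :: Ss, m => max L (g * S.h m) + commTime L g Ss (S.run m)

/-! ### The deterministic regular-oversampling sorting algorithm

The keys come from a linear order `α`; `⊤ : WithTop α` is the maximum key used for padding. -/

/-- A word is a key or a number. -/
abbrev Word (α : Type*) := WithTop α ⊕ ℕ

/-- The keys in a message. -/
def keysOf {α : Type*} (w : List (Word α)) : List (WithTop α) := w.filterMap Sum.getLeft?

/-- The first number in a message. -/
def numOf {α : Type*} (w : List (Word α)) : ℕ := (w.filterMap Sum.getRight?).headD 0

/-- Local memory of a processor: its keys, its part of the sample, the boundaries of the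
subsequences its keys are partitioned into (subsequence `i` starts at position `cut i` and ends
before position `cut (i + 1)`), and a table of storage addresses. -/
structure Mem (α : Type*) (p : ℕ) where
  keys : List (WithTop α)
  sample : List (WithTop α)
  cut : ℕ → ℕ
  table : Fin p → ℕ

section Algorithm

variable {α : Type*} [LinearOrder α] {p : ℕ}

/-- Initial memories for the input `X`, whose part `X k` resides at processor `k`. -/
def initialMem (X : Fin p → List α) : Fin p → Mem α p := fun k =>
  { keys := (X k).map (fun a => (a : WithTop α)), sample := [], cut := fun _ => 0,
    table := fun _ => 0 }

/-- Local sorting, and selection of the local sample of size `s`: the sorted local sequence, padded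
with `⊤` to `s` segments of `x` keys each, contributes the last key of each segment (so the last
sample key is the maximum of the padded sequence). Besides the sorting, `2 s` basic steps are charged
for padding and selection. -/
noncomputable def localSort (s x : ℕ) : Superstep p (Mem α p) (Word α) where
  send _ _ _ := []
  work _ m _ :=
    let X := sortSeq m.keys
    ⟨{ m with
        keys := X.val
        sample := (List.range s).map fun j => X.val.getD ((j + 1) * x - 1) ⊤ },
      X.cost + 2 * s⟩

/-- One superstep of the parallel sorting of the sample. The relation `R` splits the processors
into groups; the members of a group send each other their sorted blocks of `s` sample keys, every
member merges the blocks of its group and keeps the `i`-th part of `s` keys of the result, where `i`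
is the number of members that precede it. For groups of two this is the usual merge-split operation
that replaces a comparator when a sorting network is run on sorted blocks. -/
noncomputable def exchange (s : ℕ) (R : ℕ → ℕ → Bool) : Superstep p (Mem α p) (Word α) where
  send k m j := if R k j then m.sample.map Sum.inl else []
  work k m inbox :=
    let group : List (Fin p) := (List.finRange p).filter fun j => R k j
    let Y := mergeSeq (group.map fun j => keysOf (inbox j))
    ⟨{ m with sample := (Y.val.drop (group.countP (fun j => decide (j < k)) * s)).take s },
      Y.cost + s⟩

/-- The groups of at most two processors whose numbers differ exactly in the bits of `mask`. -/
def pairs (mask : ℕ) : ℕ → ℕ → Bool := fun i j => decide (j = i ∨ j = i ^^^ mask)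

/-- The groups of `2 ^ d` consecutive processors. -/
def blocks (d : ℕ) : ℕ → ℕ → Bool := fun i j => decide (j / 2 ^ d = i / 2 ^ d)

/-- The supersteps of Batcher's bitonic sort on `p` sorted blocks. Merge number `m` (for
`m = 1, ..., ⌈lg p⌉`) turns the sorted groups of `2 ^ (m - 1)` consecutive blocks into sorted groups
of `2 ^ m` blocks: its first level compares each block with its mirror image in the group (all bits
below `m` flipped), and its next levels compare blocks that differ in bit `m - 2`, ..., `1`, `0`;
smaller keys always go to the smaller index. (For `p` not a power of two, comparators with an index
`≥ p` are idle, as if the missing blocks were filled with `⊤`.)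
The last `d` levels of each merge act inside the groups of `2 ^ d` consecutive blocks and are carried
out together in one superstep (which sorts such a group), and so are the first `d` merges; every other level is a superstep of
its own. For `d = 1` every level of the network is one superstep. -/
def bitonicRounds (d p : ℕ) : List (ℕ → ℕ → Bool) :=
  blocks d :: (List.range' (d + 1) (Nat.clog 2 p - d)).flatMap fun m =>
    [pairs (2 ^ m - 1)] ++ ((List.range' d (m - 1 - d)).reverse.map fun j => pairs (2 ^ j)) ++
      [blocks d]

/-- Splitter broadcast and partitioning. The `p - 1` splitters are the last keys of the sample
blocks of the processors `0, ..., p - 2`, that is, the keys of rank `s, 2 s, ..., (p - 1) s` of the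
sorted sample; each is sent to all processors. By binary search every processor then finds how many
of its keys are at most each splitter. Another `p` basic steps are charged for the sizes of the `p`
subsequences so formed. -/
noncomputable def broadcast : Superstep p (Mem α p) (Word α) where
  send k m _ := if (k : ℕ) + 1 < p then m.sample.getLast?.toList.map Sum.inl else []
  work _ m inbox :=
    let S := (List.finRange p).flatMap fun j => keysOf (inbox j)
    let f : ℕ → Charged ℕ := fun i => searchSeq m.keys (S.getD (i - 1) ⊤)
    ⟨{ m with
        cut := fun i => if i = 0 then 0 else if i < p then (f i).val else m.keys.length },
      (∑ i ∈ Finset.Ico 1 p, (f i).cost) + p⟩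

/-- First superstep of the `p` independent parallel-prefix operations: processor `i` receives the
sizes of all `i`-th subsequences and computes the prefix sums, with `p` operations. -/
noncomputable def prefixSums : Superstep p (Mem α p) (Word α) where
  send _ m i := [Sum.inr (m.cut (i + 1) - m.cut i)]
  work _ m inbox :=
    ⟨{ m with table := fun k => ∑ j ∈ Finset.univ.filter (fun j => j < k), numOf (inbox j) }, p⟩

/-- Second superstep of the parallel-prefix operations: the results are returned, so that processor
`k` knows the position at which its `i`-th subsequence has to be stored at processor `i`. -/
noncomputable def addresses : Superstep p (Mem α p) (Word α) where
  send _ m k := [Sum.inr (m.table k)]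
  work _ m inbox := ⟨{ m with table := fun i => numOf (inbox i) }, p⟩

/-- Routing and merging: the `i`-th subsequence of every processor is sent to processor `i` (preceded
by its storage position there), and every processor merges the `p` sequences it receives. -/
noncomputable def route : Superstep p (Mem α p) (Word α) where
  send _ m i := Sum.inr (m.table i) ::
    ((m.keys.drop (m.cut i)).take (m.cut (i + 1) - m.cut i)).map Sum.inl
  work _ m inbox :=
    let Z := mergeSeq ((List.finRange p).map fun j => keysOf (inbox j))
    ⟨{ m with keys := Z.val }, Z.cost⟩

/-- The algorithm for `n` keys on `p` processors with oversampling parameter `r = ⌈ω⌉`, sample size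
`s = r p` per processor and segments of `x = ⌈⌈n / p⌉ / s⌉` keys. -/
noncomputable def sortDetBSP (α : Type*) [LinearOrder α] (d n p : ℕ) (ω : ℝ) :
    List (Superstep p (Mem α p) (Word α)) :=
  let s := ⌈ω⌉₊ * p
  let x := (n ⌈/⌉ p) ⌈/⌉ s
  [localSort s x] ++ (bitonicRounds d p).map (exchange s) ++
    [broadcast, prefixSums, addresses, route]

/-- The input consists of `n` distinct keys, evenly distributed: at most `⌈n / p⌉` at each
processor. -/
structure IsInput (n : ℕ) (X : Fin p → List α) : Prop where
  total : ∑ k, (X k).length = n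
  even : ∀ k, (X k).length ≤ n ⌈/⌉ p
  distinct : (List.ofFn X).flatten.Nodup

end Algorithm

/-- `n_max = (1 + 1 / ⌈ω⌉) n / p + ⌈ω⌉ p`. -/
noncomputable def nMax (n p : ℕ) (ω : ℝ) : ℝ :=
  (1 + 1 / (⌈ω⌉₊ : ℝ)) * (n / p) + ⌈ω⌉₊ * p

end BSP

/-!
Everything about the sample is expressed by thresholds, that is, by lower sets `P` of keys
(`IsThreshold`): for a sorted block of `s` keys only the number `z i` of its keys in `P` matters. A
merge-split operation turns counts `a, b` into `min s (a + b)` and `a + b - s`, and an index `i ≥ p`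
behaves as a block with `z i = 0`, so that numbers of processors other than powers of two need no
separate treatment. In this form the classical argument for Batcher's network goes through for
blocks: call a row of blocks bitonic if one cannot pick keys alternately below and above the
threshold from four of its blocks in order (`Bitonic`). The mirror level of a merge and every
half-cleaner split a group into two bitonic halves, the first of which precedes the second
(`IsPairStep.mirror`, `IsPairStep.clean`), and the final sorting inside groups of `2 ^ d` blocks
completes the merge (`IsBlockStep.separated`). Hence the splitters are the keys of rank `s`, `2 s`,
... of the sample (`bitonicRounds_sorted`).

A processor with `c` keys below a threshold contributes `c / x` sample keys below it
(`countP_sample`). Between two consecutive splitters there are fewer than `s` sample keys, so at most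
`(s - 1) x + p (x - 1) + 1 = s x + (p - 1) (x - 1)` keys (`IsCut.bucket_le`); after the last splitter
there are at most `s x`, because the last sample key of every processor is its maximum. Keys are
distinct, so that at most one of them equals a splitter, and if padding makes a splitter `⊤`, all
later subsequences are empty.

With `s = ⌈ω⌉ p` this bound is at most `nMax - (n / p) / s` (`bucketBound_le`). The term
`(n / p) / s` is essential for the computation time: the binary searches and the rounding of
`n / p` in the local sorting cost `O(p lg n)`, which is not `O(p + ω p lg² p)` when `n` is much
larger than `p`. If `lg n ≤ 6 lg p`, it is; otherwise `p ^ 6 < n`, and since `ω = O(lg n)` the saving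
`(n / p) / s` in the final merge exceeds `2 p lg n` for all large `n` (`exists_search_le`). The
remaining costs are those of `O(lg² p)` supersteps with blocks of `s` keys each, and the exact number
of supersteps (`two_mul_length_bitonicRounds`) gives the coefficient of `L`.
-/

namespace BSP

/-! ### The bitonic network on block counts -/

/-- Let `z i` be the number of keys of block `i` (a sorted block of `s` keys) that lie below some
threshold. `Separated s m j z` says that, within every group of `2 ^ m` consecutive blocks, the
subgroups of `2 ^ j` consecutive blocks are in order with respect to that threshold: a key above the
threshold never lies in an earlier subgroup than a key below it. For `j = 0` the groups are sorted. -/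
def Separated (s m j : ℕ) (z : ℕ → ℕ) : Prop :=
  ∀ i k, i / 2 ^ m = k / 2 ^ m → i / 2 ^ j < k / 2 ^ j → z i = s ∨ z k = 0

/-- Every group of `2 ^ j` consecutive blocks is bitonic: there are no four blocks in a row from
which keys can be picked that lie alternately above and below the threshold. A block with
`0 < z i < s` can stand for either side. -/
def Bitonic (s j : ℕ) (z : ℕ → ℕ) : Prop :=
  ∀ i k l n, i < k → k < l → l < n → i / 2 ^ j = n / 2 ^ j →
    ¬(z i < s ∧ 0 < z k ∧ z l < s ∧ 0 < z n) ∧ ¬(0 < z i ∧ z k < s ∧ 0 < z l ∧ z n < s)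

/-- `z'` arises from `z` by the merge-split operations on all pairs of blocks `i`, `i ^^^ mask`. -/
def IsPairStep (s mask : ℕ) (z z' : ℕ → ℕ) : Prop :=
  ∀ i, (i < i ^^^ mask → z' i = min s (z i + z (i ^^^ mask))) ∧
    (i ^^^ mask < i → z' i = z i + z (i ^^^ mask) - s)

/-- `z'` arises from `z` by sorting each group of `2 ^ d` consecutive blocks. -/
structure IsBlockStep (s d : ℕ) (z z' : ℕ → ℕ) : Prop where
  exists_lt : ∀ k, z' k < s → ∃ j, j / 2 ^ d = k / 2 ^ d ∧ z j < s
  exists_pos : ∀ k, 0 < z' k → ∃ j, j / 2 ^ d = k / 2 ^ d ∧ 0 < z j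
  sorted : ∀ i k, i / 2 ^ d = k / 2 ^ d → i < k → z' i = s ∨ z' k = 0

theorem div_two_pow_eq_of_le {a b m j : ℕ} (h : j ≤ m) (hab : a / 2 ^ j = b / 2 ^ j) :
    a / 2 ^ m = b / 2 ^ m := by
  obtain ⟨t, rfl⟩ := Nat.exists_eq_add_of_le h
  rw [pow_add, ← Nat.div_div_eq_div_mul, ← Nat.div_div_eq_div_mul, hab]

/-- Flipping bit `j` moves a number with even `i / 2 ^ j` up by `2 ^ j`, and otherwise down. -/
theorem xor_two_pow (i j : ℕ) :
    (i / 2 ^ j % 2 = 0 ∧ i ^^^ 2 ^ j = i + 2 ^ j) ∨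
      (i / 2 ^ j % 2 = 1 ∧ (i ^^^ 2 ^ j) + 2 ^ j = i) := by
  have hpos : 0 < 2 ^ j := by positivity
  have hd : (i ^^^ 2 ^ j) / 2 ^ j = (i / 2 ^ j) ^^^ 1 := by
    rw [Nat.xor_div_two_pow, Nat.div_self hpos]
  have hm : (i ^^^ 2 ^ j) % 2 ^ j = i % 2 ^ j := by
    rw [Nat.xor_mod_two_pow, Nat.mod_self, Nat.xor_zero]
  have e1 := Nat.div_add_mod (i ^^^ 2 ^ j) (2 ^ j)
  have e2 := Nat.div_add_mod i (2 ^ j)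
  rw [hd, hm] at e1
  rcases Nat.mod_two_eq_zero_or_one (i / 2 ^ j) with h | h
  · left
    rw [Nat.xor_one_of_even (Nat.even_iff.2 h), mul_add, mul_one] at e1
    exact ⟨h, by omega⟩
  · right
    have h1 : 2 ^ j * (i / 2 ^ j) = 2 ^ j * (i / 2 ^ j - 1) + 2 ^ j := by
      generalize i / 2 ^ j = q at h
      obtain ⟨q, rfl⟩ : ∃ t, q = t + 1 := ⟨q - 1, by omega⟩
      rfl
    rw [Nat.xor_one_of_odd (Nat.odd_iff.2 h)] at e1
    exact ⟨h, by omega⟩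

/-- Flipping all bits below `m` reflects each group of `2 ^ m` consecutive numbers. -/
theorem xor_two_pow_sub_one (i m : ℕ) :
    (i ^^^ (2 ^ m - 1)) / 2 ^ m = i / 2 ^ m ∧
      (i ^^^ (2 ^ m - 1)) % 2 ^ m + i % 2 ^ m = 2 ^ m - 1 := by
  have hpos : 0 < 2 ^ m := by positivity
  have hlt : i % 2 ^ m < 2 ^ m := Nat.mod_lt _ hpos
  refine ⟨?_, ?_⟩
  · rw [Nat.xor_div_two_pow, Nat.div_eq_of_lt (by omega : 2 ^ m - 1 < 2 ^ m), Nat.xor_zero]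
  · have : (i ^^^ (2 ^ m - 1)) % 2 ^ m = 2 ^ m - (i % 2 ^ m + 1) := by
      rw [Nat.xor_mod_two_pow, Nat.mod_eq_of_lt (by omega : 2 ^ m - 1 < 2 ^ m)]
      apply Nat.eq_of_testBit_eq
      intro k
      rw [Nat.testBit_two_pow_sub_succ hlt, Nat.testBit_xor, Nat.testBit_two_pow_sub_one]
      by_cases hk : k < m
      · simp [hk]
      · simp [hk]
    omega

theorem half_div (i j : ℕ) : i / 2 ^ (j + 1) = i / 2 ^ j / 2 := by
  rw [pow_succ, Nat.div_div_eq_div_mul]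

theorem add_two_pow_div (i j : ℕ) : (i + 2 ^ j) / 2 ^ j = i / 2 ^ j + 1 :=
  Nat.add_div_right _ (by positivity)

/-- A half-cleaner splits every bitonic group into two bitonic halves, the first of which precedes
the second. -/
theorem IsPairStep.clean {s m j : ℕ} {z z' : ℕ → ℕ} (hs : 0 < s) (hz : ∀ i, z i ≤ s)
    (hst : IsPairStep s (2 ^ j) z z') (hjm : j + 1 ≤ m)
    (hsep : Separated s m (j + 1) z) (hbit : Bitonic s (j + 1) z) :
    Separated s m j z' ∧ Bitonic s j z' := by
  have hpos : 0 < 2 ^ j := by positivity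
  have hlow : ∀ i, i / 2 ^ j % 2 = 0 → z' i = min s (z i + z (i + 2 ^ j)) := by
    intro i hi
    rcases xor_two_pow i j with ⟨_, h⟩ | ⟨h, _⟩
    · have := (hst i).1 (by omega)
      rwa [h] at this
    · omega
  have hhigh : ∀ i, i / 2 ^ j % 2 = 0 → z' (i + 2 ^ j) = z i + z (i + 2 ^ j) - s := by
    intro i hi
    have h2 := add_two_pow_div i j
    rcases xor_two_pow (i + 2 ^ j) j with ⟨h, _⟩ | ⟨_, h⟩
    · omega
    · have h3 : (i + 2 ^ j) ^^^ 2 ^ j = i := by omega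
      have := (hst (i + 2 ^ j)).2 (by omega)
      rw [h3] at this
      omega
  -- every block is the lower or the upper member of a pair
  have hpair : ∀ i, i / 2 ^ j % 2 = 0 ∨ ∃ i₀, i = i₀ + 2 ^ j ∧ i₀ / 2 ^ j % 2 = 0 := by
    intro i
    rcases xor_two_pow i j with ⟨h, _⟩ | ⟨h, h'⟩
    · exact Or.inl h
    · refine Or.inr ⟨i ^^^ 2 ^ j, h'.symm, ?_⟩
      have := add_two_pow_div (i ^^^ 2 ^ j) j
      rw [h'] at this
      omega
  have hgrp : ∀ i, i / 2 ^ j % 2 = 0 → (i + 2 ^ j) / 2 ^ (j + 1) = i / 2 ^ (j + 1) := by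
    intro i hi
    rw [half_div, half_div, add_two_pow_div]
    omega
  -- keys of a block after the step come from its pair
  have hex : ∀ i, (z' i < s → ∃ i₁, i₁ / 2 ^ (j + 1) = i / 2 ^ (j + 1) ∧ z i₁ < s) ∧
      (0 < z' i → ∃ i₁, i₁ / 2 ^ (j + 1) = i / 2 ^ (j + 1) ∧ 0 < z i₁) := by
    intro i
    rcases hpair i with hi | ⟨i, rfl, hi⟩
    · have h1 := hlow i hi
      refine ⟨fun h => ⟨i, rfl, by omega⟩, fun h => ?_⟩
      by_cases h0 : 0 < z i
      · exact ⟨i, rfl, h0⟩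
      · exact ⟨i + 2 ^ j, hgrp i hi, by omega⟩
    · have h1 := hhigh i hi
      have := hz i
      have := hz (i + 2 ^ j)
      refine ⟨fun h => ?_, fun h => ⟨i + 2 ^ j, rfl, by omega⟩⟩
      by_cases h0 : z i < s
      · exact ⟨i, (hgrp i hi).symm, h0⟩
      · exact ⟨i + 2 ^ j, rfl, by omega⟩
  refine ⟨?_, ?_⟩
  · intro i k him hik
    by_contra hcon
    push Not at hcon
    rcases Nat.lt_or_ge (i / 2 ^ (j + 1)) (k / 2 ^ (j + 1)) with hlt | hge
    · have hzi : z' i < s := by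
        rcases hpair i with hi | ⟨i, rfl, hi⟩
        · have := hlow i hi; omega
        · have := hhigh i hi; have := hz i; have := hz (i + 2 ^ j); omega
      obtain ⟨i₁, hi₁, hzi₁⟩ := (hex i).1 hzi
      obtain ⟨k₁, hk₁, hzk₁⟩ := (hex k).2 (by omega)
      have h1 := div_two_pow_eq_of_le hjm hi₁
      have h2 := div_two_pow_eq_of_le hjm hk₁
      rcases hsep i₁ k₁ (by omega) (by omega) with h | h <;> omega
    · -- the two blocks lie in the two halves of one group
      rw [half_div, half_div] at hge
      rcases hpair i with hi | ⟨i, rfl, hi⟩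
      · rcases hpair k with hk | ⟨k, rfl, hk⟩
        · omega
        · have hkd := add_two_pow_div k j
          have h1 := hlow i hi
          have h2 := hhigh k hk
          have := hz k
          have := hz (k + 2 ^ j)
          have hik' : i / 2 ^ j = k / 2 ^ j := by omega
          have e1 := Nat.div_add_mod i (2 ^ j)
          have e2 := Nat.div_add_mod k (2 ^ j)
          have l1 := Nat.mod_lt i hpos
          have l2 := Nat.mod_lt k hpos
          rw [hik'] at e1
          rcases lt_trichotomy i k with hlt | rfl | hgt
          · refine (hbit i k (i + 2 ^ j) (k + 2 ^ j) hlt (by omega) (by omega) ?_).1 ?_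
            · rw [hgrp k hk, half_div, half_div, hik']
            · omega
          · omega
          · refine (hbit k i (k + 2 ^ j) (i + 2 ^ j) hgt (by omega) (by omega) ?_).2 ?_
            · rw [hgrp i hi, half_div, half_div, hik']
            · omega
      · have hid := add_two_pow_div i j
        omega
  · -- four blocks of one half, with their partners in the other half
    have quad : ∀ i k l n, i < k → k < l → l < n → i / 2 ^ j % 2 = 0 → i / 2 ^ j = n / 2 ^ j →
        ¬(z' i < s ∧ 0 < z' k ∧ z' l < s ∧ 0 < z' n) ∧
        ¬(0 < z' i ∧ z' k < s ∧ 0 < z' l ∧ z' n < s) ∧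
        ¬(z' (i + 2 ^ j) < s ∧ 0 < z' (k + 2 ^ j) ∧ z' (l + 2 ^ j) < s ∧ 0 < z' (n + 2 ^ j)) ∧
        ¬(0 < z' (i + 2 ^ j) ∧ z' (k + 2 ^ j) < s ∧ 0 < z' (l + 2 ^ j) ∧ z' (n + 2 ^ j) < s) := by
      intro i k l n hik hkl hln hi hin
      have hk' : k / 2 ^ j = i / 2 ^ j :=
        le_antisymm (hin ▸ Nat.div_le_div_right (by omega)) (Nat.div_le_div_right hik.le)
      have hl' : l / 2 ^ j = i / 2 ^ j :=
        le_antisymm (hin ▸ Nat.div_le_div_right hln.le) (Nat.div_le_div_right (by omega))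
      have e1 := Nat.div_add_mod i (2 ^ j)
      have e2 := Nat.div_add_mod n (2 ^ j)
      have l1 := Nat.mod_lt i hpos
      have l2 := Nat.mod_lt n hpos
      rw [hin] at e1
      have g : ∀ a b, a / 2 ^ j = i / 2 ^ j → b / 2 ^ j = i / 2 ^ j →
          a / 2 ^ (j + 1) = b / 2 ^ (j + 1) := fun a b ha hb => by
        rw [half_div, half_div, ha, hb]
      have g' : ∀ a b, a / 2 ^ j = i / 2 ^ j → b / 2 ^ j = i / 2 ^ j →
          a / 2 ^ (j + 1) = (b + 2 ^ j) / 2 ^ (j + 1) := fun a b ha hb => by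
        rw [hgrp b (by omega)]; exact g a b ha hb
      have b1 := hbit i k l n hik hkl hln (g _ _ rfl hin.symm)
      have b2 := hbit i k l (n + 2 ^ j) hik hkl (by omega) (g' _ _ rfl hin.symm)
      have b3 := hbit i k (l + 2 ^ j) (n + 2 ^ j) hik (by omega) (by omega) (g' _ _ rfl hin.symm)
      have b4 := hbit (i + 2 ^ j) (k + 2 ^ j) (l + 2 ^ j) (n + 2 ^ j) (by omega) (by omega)
        (by omega) (by rw [hgrp i hi, g' i n rfl hin.symm])
      have b5 := hbit l n (i + 2 ^ j) (k + 2 ^ j) hln (by omega) (by omega) (g' _ _ hl' hk')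
      have two : ∀ a b, z a + z b < 2 * s → z a < s ∨ z b < s := fun a b h => by omega
      have one : ∀ a b, 0 < z a + z b → 0 < z a ∨ 0 < z b := fun a b h => by omega
      have := hlow i hi
      have := hlow k (by omega)
      have := hlow l (by omega)
      have := hlow n (by omega)
      have := hhigh i hi
      have := hhigh k (by omega)
      have := hhigh l (by omega)
      have := hhigh n (by omega)
      have := hz i
      have := hz k
      have := hz l
      have := hz n
      have := hz (i + 2 ^ j)
      have := hz (k + 2 ^ j)
      have := hz (l + 2 ^ j)
      have := hz (n + 2 ^ j)
      refine ⟨?_, ?_, ?_, ?_⟩ <;> rintro ⟨h1, h2, h3, h4⟩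
      · rcases one k (k + 2 ^ j) (by omega) with h | h <;>
          rcases one n (n + 2 ^ j) (by omega) with h' | h'
        · exact b1.1 (by omega)
        · exact b2.1 (by omega)
        · exact b5.1 (by omega)
        · exact b4.1 (by omega)
      · rcases one i (i + 2 ^ j) (by omega) with h | h <;>
          rcases one l (l + 2 ^ j) (by omega) with h' | h'
        · exact b1.2 (by omega)
        · exact b3.2 (by omega)
        · exact b5.2 (by omega)
        · exact b4.2 (by omega)
      · rcases two i (i + 2 ^ j) (by omega) with h | h <;>
          rcases two l (l + 2 ^ j) (by omega) with h' | h'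
        · exact b1.1 (by omega)
        · exact b3.1 (by omega)
        · exact b5.1 (by omega)
        · exact b4.1 (by omega)
      · rcases two k (k + 2 ^ j) (by omega) with h | h <;>
          rcases two n (n + 2 ^ j) (by omega) with h' | h'
        · exact b1.2 (by omega)
        · exact b2.2 (by omega)
        · exact b5.2 (by omega)
        · exact b4.2 (by omega)
    intro i k l n hik hkl hln hin
    rcases hpair i with hi | ⟨i, rfl, hi⟩
    · have := quad i k l n hik hkl hln hi hin
      exact ⟨this.1, this.2.1⟩
    · obtain ⟨k, rfl⟩ := Nat.exists_eq_add_of_le' (show 2 ^ j ≤ k by omega)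
      obtain ⟨l, rfl⟩ := Nat.exists_eq_add_of_le' (show 2 ^ j ≤ l by omega)
      obtain ⟨n, rfl⟩ := Nat.exists_eq_add_of_le' (show 2 ^ j ≤ n by omega)
      rw [add_two_pow_div, add_two_pow_div] at hin
      have := quad i k l n (by omega) (by omega) (by omega) hi (by omega)
      exact ⟨this.2.2.1, this.2.2.2⟩

/-- The first level of a merge, which compares each block of a group of two sorted halves with its
mirror image, leaves two bitonic halves, the first of which precedes the second. -/
theorem IsPairStep.mirror {s j : ℕ} {z z' : ℕ → ℕ} (hz : ∀ i, z i ≤ s)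
    (hst : IsPairStep s (2 ^ (j + 1) - 1) z z') (hsep : Separated s j 0 z) :
    Separated s (j + 1) j z' ∧ Bitonic s j z' := by
  have hpos : 0 < 2 ^ j := by positivity
  have hp2 : 2 ^ (j + 1) = 2 ^ j + 2 ^ j := by ring
  have hsort : ∀ i k, i / 2 ^ j = k / 2 ^ j → i < k → z i = s ∨ z k = 0 := fun i k h h' =>
    hsep i k h (by simpa using h')
  -- `σ` is the reflection of the groups
  obtain ⟨σ, hσ⟩ : ∃ σ : ℕ → ℕ, ∀ i, σ i = i ^^^ (2 ^ (j + 1) - 1) := ⟨_, fun _ => rfl⟩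
  have hinv : ∀ i, σ (σ i) = i := fun i => by simp [hσ]
  have hlow : ∀ i, i < σ i → z' i = min s (z i + z (σ i)) := fun i h => by
    rw [hσ] at h ⊢; exact (hst i).1 h
  have hhigh : ∀ i, σ i < i → z' i = z i + z (σ i) - s := fun i h => by
    rw [hσ] at h ⊢; exact (hst i).2 h
  have hσ1 : ∀ i, σ i / 2 ^ (j + 1) = i / 2 ^ (j + 1) := fun i => by
    rw [hσ]; exact (xor_two_pow_sub_one i (j + 1)).1
  have hσ2 : ∀ i, σ i % 2 ^ (j + 1) + i % 2 ^ (j + 1) = 2 ^ (j + 1) - 1 := fun i => by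
    rw [hσ]; exact (xor_two_pow_sub_one i (j + 1)).2
  have hsum : ∀ i k, i / 2 ^ (j + 1) = k / 2 ^ (j + 1) → σ i + i = σ k + k := by
    intro i k h
    have e1 := Nat.div_add_mod i (2 ^ (j + 1))
    have e2 := Nat.div_add_mod (σ i) (2 ^ (j + 1))
    have e3 := Nat.div_add_mod k (2 ^ (j + 1))
    have e4 := Nat.div_add_mod (σ k) (2 ^ (j + 1))
    rw [hσ1] at e2 e4
    rw [h] at e1 e2
    have := hσ2 i
    have := hσ2 k
    omega
  have hdiv : ∀ i, i / 2 ^ j + σ i / 2 ^ j = 2 * (2 * (i / 2 ^ (j + 1))) + 1 := by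
    intro i
    have hd : ∀ a, a / 2 ^ j = 2 * (a / 2 ^ (j + 1)) + (a % 2 ^ (j + 1)) / 2 ^ j := by
      intro a
      have e1 := Nat.div_add_mod a (2 ^ (j + 1))
      conv_lhs => rw [← e1, pow_succ, mul_assoc, Nat.mul_add_div hpos]
      rw [pow_succ]
    have l1 := Nat.mod_lt i (by positivity : 0 < 2 ^ (j + 1))
    have l2 := Nat.mod_lt (σ i) (by positivity : 0 < 2 ^ (j + 1))
    have := hσ2 i
    have hone : ∀ a, 2 ^ j ≤ a → a < 2 ^ j + 2 ^ j → a / 2 ^ j = 1 := fun a h h' =>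
      Nat.div_eq_of_lt_le (by omega) (by omega)
    rw [hd i, hd (σ i), hσ1]
    rcases Nat.lt_or_ge (i % 2 ^ (j + 1)) (2 ^ j) with h | h
    · rw [Nat.div_eq_of_lt h, hone _ (by omega) (by omega)]; omega
    · rw [Nat.div_eq_of_lt (a := σ i % 2 ^ (j + 1)) (by omega),
        hone _ h (by omega)]; omega
  -- the lower members of the pairs are the blocks of the lower half
  have hside : ∀ i, (i / 2 ^ j % 2 = 0 ∧ i < σ i) ∨ (i / 2 ^ j % 2 = 1 ∧ σ i < i) := by
    intro i
    have h1 := hdiv i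
    have h2 := half_div i j
    rcases Nat.mod_two_eq_zero_or_one (i / 2 ^ j) with h | h
    · refine Or.inl ⟨h, lt_of_not_ge fun hc => ?_⟩
      have := Nat.div_le_div_right (c := 2 ^ j) hc
      omega
    · refine Or.inr ⟨h, lt_of_not_ge fun hc => ?_⟩
      have := Nat.div_le_div_right (c := 2 ^ j) hc
      omega
  have hsame : ∀ i k, i / 2 ^ j = k / 2 ^ j → σ i / 2 ^ j = σ k / 2 ^ j := by
    intro i k h
    have := hdiv i
    have := hdiv k
    have := half_div i j
    have := half_div k j
    omega
  refine ⟨?_, ?_⟩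
  · intro i k him hik
    by_contra hcon
    push Not at hcon
    have hi : i / 2 ^ j % 2 = 0 ∧ i < σ i := by
      have := hside i
      rw [half_div, half_div] at him
      omega
    have hk : k / 2 ^ j % 2 = 1 ∧ σ k < k := by
      have := hside k
      rw [half_div, half_div] at him
      omega
    have h1 := hlow i hi.2
    have h2 := hhigh k hk.2
    have hd1 := hdiv i
    have hd2 := hdiv k
    have hm1 := half_div i j
    have hm2 := half_div k j
    have := hz k
    have := hz (σ k)
    have hs := hsum i k him
    rcases lt_trichotomy i (σ k) with hlt | heq | hgt
    · rcases hsort i (σ k) (by omega) hlt with h | h <;> omega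
    · have : σ i = k := by rw [heq, hinv]
      rw [this] at h1
      rw [← heq] at h2
      omega
    · rcases hsort (σ i) k (by omega) (by omega) with h | h <;> omega
  · intro i k l n hik hkl hln hin
    have hk' : i / 2 ^ j = k / 2 ^ j :=
      le_antisymm (Nat.div_le_div_right hik.le) (hin ▸ Nat.div_le_div_right (by omega))
    have hl' : i / 2 ^ j = l / 2 ^ j :=
      le_antisymm (Nat.div_le_div_right (by omega)) (hin ▸ Nat.div_le_div_right hln.le)
    have g : ∀ a b, i / 2 ^ j = a / 2 ^ j → i / 2 ^ j = b / 2 ^ j → a < b →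
        (z a = s ∨ z b = 0) ∧ (z (σ b) = s ∨ z (σ a) = 0) := fun a b ha hb hab => by
      have hs := hsum a b (by rw [half_div, half_div]; omega)
      exact ⟨hsort a b (by omega) hab, hsort (σ b) (σ a) (hsame b a (by omega)) (by omega)⟩
    have g1 := g i k rfl hk' hik
    have g2 := g k l hk' hl' hkl
    have g3 := g l n hl' hin hln
    have := hz i
    have := hz k
    have := hz l
    have := hz n
    have := hz (σ i)
    have := hz (σ k)
    have := hz (σ l)
    have := hz (σ n)
    rcases Nat.mod_two_eq_zero_or_one (i / 2 ^ j) with h | h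
    · have hl : ∀ a, i / 2 ^ j = a / 2 ^ j → z' a = min s (z a + z (σ a)) := fun a ha =>
        hlow a (by have := hside a; omega)
      have := hl i rfl
      have := hl k hk'
      have := hl l hl'
      have := hl n hin
      constructor <;> omega
    · have hl : ∀ a, i / 2 ^ j = a / 2 ^ j → z' a = z a + z (σ a) - s := fun a ha =>
        hhigh a (by have := hside a; omega)
      have := hl i rfl
      have := hl k hk'
      have := hl l hl'
      have := hl n hin
      constructor <;> omega

/-- Sorting the groups of `2 ^ d` blocks completes a merge whose earlier levels have separated
them. -/
theorem IsBlockStep.separated {s d m : ℕ} {z z' : ℕ → ℕ} (hz' : ∀ i, z' i ≤ s)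
    (hst : IsBlockStep s d z z') (hdm : d ≤ m) (hsep : Separated s m d z) :
    Separated s m 0 z' := by
  intro i k him hik
  simp only [pow_zero, Nat.div_one] at hik
  by_contra hcon
  push Not at hcon
  rcases (Nat.div_le_div_right (c := 2 ^ d) hik.le).eq_or_lt with h | h
  · rcases hst.sorted i k h hik with h' | h' <;> omega
  · obtain ⟨i₁, hi₁, hzi⟩ := hst.exists_lt i (by have := hz' i; omega)
    obtain ⟨k₁, hk₁, hzk⟩ := hst.exists_pos k (by omega)
    have h1 := div_two_pow_eq_of_le hdm hi₁
    have h2 := div_two_pow_eq_of_le hdm hk₁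
    rcases hsep i₁ k₁ (by omega) (by omega) with h | h <;> omega

theorem separated_self (s d : ℕ) (z : ℕ → ℕ) : Separated s d d z := fun _ _ h h' => by omega

/-! ### Sorted lists and thresholds -/

/-- A threshold, as the set of keys below it. Strict and non-strict thresholds `· < t`, `· ≤ t` are
both of this form. -/
def IsThreshold {κ : Type*} [LE κ] (P : κ → Bool) : Prop := ∀ a b, a ≤ b → P b = true → P a = true

section Lists

variable {κ : Type*} [LinearOrder κ]

theorem isThreshold_lt (t : κ) : IsThreshold fun b => decide (b < t) := fun _ _ h h' => by
  simp only [decide_eq_true_eq] at h' ⊢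
  exact h.trans_lt h'

theorem isThreshold_le (t : κ) : IsThreshold fun b => decide (b ≤ t) := fun _ _ h h' => by
  simp only [decide_eq_true_eq] at h' ⊢
  exact h.trans h'

theorem mergeSort_pairwise (l : List κ) :
    (l.mergeSort (fun a b => decide (a ≤ b))).Pairwise (· ≤ ·) := by
  have := List.pairwise_mergeSort (le := fun a b : κ => decide (a ≤ b))
    (fun a b c => by simpa using le_trans) (fun a b => by simpa using le_total a b) l
  simpa using this

theorem mergeSeq_perm (ls : List (List κ)) : (mergeSeq ls).val.Perm ls.flatten := by
  unfold mergeSeq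
  induction ls with
  | nil => simp
  | cons a ls ih =>
    simp only [List.foldr_cons, List.flatten_cons] at ih ⊢
    exact (List.merge_perm_append _).trans (ih.append_left a)

theorem mergeSeq_pairwise (ls : List (List κ)) (h : ∀ l ∈ ls, l.Pairwise (· ≤ ·)) :
    (mergeSeq ls).val.Pairwise (· ≤ ·) := by
  unfold mergeSeq
  induction ls with
  | nil => simp
  | cons a ls ih =>
    simp only [List.foldr_cons] at ih ⊢
    have := List.pairwise_merge (le := fun a b : κ => decide (a ≤ b))
      (fun a b c => by simpa using le_trans) (fun a b => by simpa using le_total a b) a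
      (List.foldr (fun a b => a.merge b fun u v => decide (u ≤ v)) [] ls)
      (by simpa using h a (by simp)) (by simpa using ih fun l hl => h l (by simp [hl]))
    simpa using this

variable {P : κ → Bool}

theorem countP_eq_zero_of_pairwise_cons (hP : IsThreshold P) {x : κ} {l : List κ}
    (h : (x :: l).Pairwise (· ≤ ·)) (hx : ¬P x = true) : l.countP P = 0 := by
  rw [List.countP_eq_zero]
  intro a ha hPa
  exact hx (hP x a (List.rel_of_pairwise_cons h ha) hPa)

theorem countP_drop (hP : IsThreshold P) {l : List κ} (h : l.Pairwise (· ≤ ·)) (a : ℕ) :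
    (l.drop a).countP P = l.countP P - a := by
  induction l generalizing a with
  | nil => simp
  | cons x l ih =>
    cases a with
    | zero => simp
    | succ a =>
      rw [List.drop_succ_cons, ih h.of_cons, List.countP_cons]
      by_cases hx : P x = true
      · simp [hx]
      · have := countP_eq_zero_of_pairwise_cons hP h hx
        simp [hx, this]

theorem countP_take (hP : IsThreshold P) {l : List κ} (h : l.Pairwise (· ≤ ·)) (a : ℕ) :
    (l.take a).countP P = min a (l.countP P) := by
  induction l generalizing a with
  | nil => simp
  | cons x l ih =>
    cases a with
    | zero => simp
    | succ a =>
      rw [List.take_succ_cons, List.countP_cons, ih h.of_cons, List.countP_cons]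
      by_cases hx : P x = true
      · simp only [hx, if_true]
        omega
      · have := countP_eq_zero_of_pairwise_cons hP h hx
        simp [hx, this]

/-- In a sorted list the keys below a threshold are the first ones. -/
theorem getElem_iff_lt_countP (hP : IsThreshold P) {l : List κ} (h : l.Pairwise (· ≤ ·)) (i : ℕ)
    (hi : i < l.length) : P l[i] = true ↔ i < l.countP P := by
  have h1 := countP_drop hP h i
  rw [List.drop_eq_getElem_cons hi, List.countP_cons] at h1
  constructor
  · intro hPi
    rw [if_pos hPi] at h1
    omega
  · intro hlt
    by_contra hPi
    have hs : (l[i] :: l.drop (i + 1)).Pairwise (· ≤ ·) := by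
      rw [← List.drop_eq_getElem_cons hi]
      exact h.sublist (List.drop_sublist _ _)
    rw [if_neg hPi, countP_eq_zero_of_pairwise_cons hP hs hPi] at h1
    omega

end Lists

/-! ### Merge-split operations within groups of processors -/

section Exchange

variable {α : Type*} {p : ℕ}

/-- The number of keys below a threshold in the block of processor `i`. Blocks of index at least `p`
are regarded as filled with maximum keys. -/
def belowCount (P : WithTop α → Bool) (m : Fin p → Mem α p) (i : ℕ) : ℕ :=
  if h : i < p then (m ⟨i, h⟩).sample.countP P else 0

@[simp]
theorem belowCount_val (P : WithTop α → Bool) (m : Fin p → Mem α p) (k : Fin p) :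
    belowCount P m k = (m k).sample.countP P := by
  simp [belowCount]

theorem belowCount_of_le (P : WithTop α → Bool) (m : Fin p → Mem α p) {i : ℕ} (h : p ≤ i) :
    belowCount P m i = 0 := by
  simp [belowCount, h]

theorem keysOf_map_inl (l : List (WithTop α)) :
    keysOf (l.map (Sum.inl : WithTop α → Word α)) = l := by
  have : Sum.getLeft? ∘ (Sum.inl : WithTop α → Word α) = some := rfl
  rw [keysOf, List.filterMap_map, this, List.filterMap_some]

variable [LinearOrder α]

/-- Every processor holds a sorted block of `s` sample keys. -/
def HasBlocks (s : ℕ) (m : Fin p → Mem α p) : Prop :=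
  ∀ k, (m k).sample.Pairwise (· ≤ ·) ∧ (m k).sample.length = s

theorem HasBlocks.belowCount_le {s : ℕ} {m : Fin p → Mem α p} (h : HasBlocks s m)
    (P : WithTop α → Bool) (i : ℕ) : belowCount P m i ≤ s := by
  unfold belowCount
  split_ifs with hi
  · exact (List.countP_le_length).trans (h _).2.le
  · exact Nat.zero_le _

/-- The grouping relation `R` has as its classes the fibres of `f`. -/
def IsKernel (R : ℕ → ℕ → Bool) (f : ℕ → ℕ) : Prop := ∀ i j, R i j = true ↔ f i = f j

theorem IsKernel.iff_symm {R : ℕ → ℕ → Bool} {f : ℕ → ℕ} (hR : IsKernel R f) (i j : ℕ) :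
    R i j = true ↔ f j = f i := (hR i j).trans eq_comm

/-- The processors of the group with label `y`. -/
def fiber (p : ℕ) (f : ℕ → ℕ) (y : ℕ) : Finset (Fin p) :=
  Finset.univ.filter fun j : Fin p => f j = y

@[simp]
theorem mem_fiber {f : ℕ → ℕ} {y : ℕ} {j : Fin p} : j ∈ fiber p f y ↔ f j = y := by
  simp [fiber]

theorem sum_map_filter_finRange (q : Fin p → Bool) (g : Fin p → ℕ) :
    (((List.finRange p).filter q).map g).sum = ∑ j with q j = true, g j := by
  rw [← List.sum_toFinset g ((List.nodup_finRange p).filter _)]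
  congr 1
  ext j
  simp

theorem countP_filter_finRange (q r : Fin p → Bool) :
    ((List.finRange p).filter q).countP r =
      (Finset.univ.filter fun j => q j = true ∧ r j = true).card := by
  rw [List.countP_eq_length_filter, List.filter_filter,
    ← List.toFinset_card_of_nodup ((List.nodup_finRange p).filter _)]
  congr 1
  ext j
  simp [and_comm]

/-- The list that the members of a group merge in an `exchange` superstep. -/
theorem exchange_group {s : ℕ} {R : ℕ → ℕ → Bool} {f : ℕ → ℕ} (hR : IsKernel R f)
    (m : Fin p → Mem α p) (k : Fin p) :
    (((List.finRange p).filter fun j : Fin p => R k j).map fun j =>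
        keysOf ((exchange s R).send j (m j) k)) =
      ((List.finRange p).filter fun j : Fin p => R k j).map fun j => (m j).sample := by
  refine List.map_congr_left fun j hj => ?_
  have h1 : R k j = true := (List.mem_filter.1 hj).2
  have h2 : R j k = true := (hR _ _).2 ((hR _ _).1 h1).symm
  simp [exchange, h2, keysOf_map_inl]

/-- The blocks after an `exchange` superstep are consecutive parts of the sorted groups. -/
theorem exchange_block {s : ℕ} {R : ℕ → ℕ → Bool} {f : ℕ → ℕ} (hR : IsKernel R f)
    {m : Fin p → Mem α p} (hm : HasBlocks s m) (k : Fin p) :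
    ∃ Y : List (WithTop α), Y.Pairwise (· ≤ ·) ∧
      Y.Perm (((List.finRange p).filter fun j : Fin p => R k j).map fun j => (m j).sample).flatten ∧
      ((exchange s R).run m k).sample =
        (Y.drop (((fiber p f (f k)).filter (· < k)).card * s)).take s := by
  refine ⟨_, mergeSeq_pairwise (((List.finRange p).filter fun j : Fin p => R k j).map fun j =>
    (m j).sample) ?_, mergeSeq_perm _, ?_⟩
  · intro l hl
    obtain ⟨j, _, rfl⟩ := List.mem_map.1 hl
    exact (hm j).1
  · rw [← exchange_group (s := s) hR m k]
    have : ((fiber p f (f k)).filter (· < k)).card =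
        ((List.finRange p).filter fun j : Fin p => R k j).countP fun j => decide (j < k) := by
      rw [countP_filter_finRange]
      congr 1
      ext j
      simp [hR.iff_symm]
    rw [this]
    rfl

theorem card_before_lt {f : ℕ → ℕ} (k : Fin p) :
    ((fiber p f (f k)).filter (· < k)).card <
      (fiber p f (f k)).card := by
  refine Finset.card_lt_card (Finset.filter_ssubset.2 ⟨k, by simp, by simp⟩)

theorem HasBlocks.run_exchange {s : ℕ} {R : ℕ → ℕ → Bool} {f : ℕ → ℕ} (hR : IsKernel R f)
    {m : Fin p → Mem α p} (hm : HasBlocks s m) : HasBlocks s ((exchange s R).run m) := by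
  intro k
  obtain ⟨Y, hY, hperm, hk⟩ := exchange_block hR hm k
  rw [hk]
  refine ⟨(hY.sublist (List.drop_sublist _ _)).sublist (List.take_sublist _ _), ?_⟩
  have hlen : Y.length = (fiber p f (f k)).card * s := by
    rw [hperm.length_eq, List.length_flatten, List.map_map]
    have : (List.length ∘ fun j : Fin p => (m j).sample) = fun _ => s := funext fun j => (hm j).2
    rw [this, sum_map_filter_finRange, Finset.sum_const, smul_eq_mul]
    congr 2
    ext j
    simp [hR.iff_symm]
  have hlt := card_before_lt (f := f) k
  rw [List.length_take, List.length_drop, hlen]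
  have : (((fiber p f (f k)).filter (· < k)).card + 1) * s ≤
      (fiber p f (f k)).card * s := Nat.mul_le_mul_right _ hlt
  rw [add_mul] at this
  omega

theorem countP_exchange {s : ℕ} {R : ℕ → ℕ → Bool} {f : ℕ → ℕ} (hR : IsKernel R f)
    {m : Fin p → Mem α p} (hm : HasBlocks s m) {P : WithTop α → Bool} (hP : IsThreshold P)
    (k : Fin p) :
    ((exchange s R).run m k).sample.countP P =
      min s ((∑ j ∈ fiber p f (f k), (m j).sample.countP P) -
        ((fiber p f (f k)).filter (· < k)).card * s) := by
  obtain ⟨Y, hY, hperm, hk⟩ := exchange_block hR hm k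
  rw [hk, countP_take hP (hY.sublist (List.drop_sublist _ _)), countP_drop hP hY,
    hperm.countP_eq, List.countP_flatten, List.map_map, sum_map_filter_finRange]
  congr 3
  ext j
  simp [hR.iff_symm]

theorem sum_min_sub_card {ι : Type*} [LinearOrder ι] (A : Finset ι) (s Z : ℕ) :
    ∑ k ∈ A, min s (Z - (A.filter (· < k)).card * s) = min (A.card * s) Z := by
  induction A using Finset.induction_on_max with
  | empty => simp
  | insert a A ha ih =>
    have hna : a ∉ A := fun h => lt_irrefl _ (ha a h)
    have h1 : (insert a A).filter (· < a) = A := by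
      ext j
      simp only [Finset.mem_filter, Finset.mem_insert]
      constructor
      · rintro ⟨rfl | h, h'⟩
        · exact absurd h' (lt_irrefl _)
        · exact h
      · exact fun h => ⟨Or.inr h, ha j h⟩
    rw [Finset.sum_insert hna, h1, Finset.card_insert_of_notMem hna]
    have h2 : ∑ k ∈ A, min s (Z - ((insert a A).filter (· < k)).card * s) =
        ∑ k ∈ A, min s (Z - (A.filter (· < k)).card * s) := by
      refine Finset.sum_congr rfl fun k hk => ?_
      rw [Finset.filter_insert, if_neg (ha k hk).le.not_gt]
    rw [h2, ih, add_mul]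
    omega

/-- An `exchange` superstep only permutes the sample. -/
theorem sum_countP_exchange {s : ℕ} {R : ℕ → ℕ → Bool} {f : ℕ → ℕ} (hR : IsKernel R f)
    {m : Fin p → Mem α p} (hm : HasBlocks s m) {P : WithTop α → Bool} (hP : IsThreshold P) :
    ∑ k, ((exchange s R).run m k).sample.countP P = ∑ k, (m k).sample.countP P := by
  have hmem : ∀ i ∈ (Finset.univ : Finset (Fin p)),
      f i ∈ Finset.univ.image fun i : Fin p => f i := fun i _ =>
    Finset.mem_image_of_mem (fun i : Fin p => f i) (Finset.mem_univ i)
  rw [← Finset.sum_fiberwise_of_maps_to hmem, ← Finset.sum_fiberwise_of_maps_to hmem]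
  refine Finset.sum_congr rfl fun y _ => ?_
  have h1 : ∀ k ∈ Finset.univ.filter (fun i : Fin p => f i = y),
      ((exchange s R).run m k).sample.countP P =
        min s ((∑ j ∈ fiber p f y, (m j).sample.countP P) -
          ((fiber p f y).filter (· < k)).card * s) := by
    intro k hk
    rw [countP_exchange hR hm hP k, (Finset.mem_filter.1 hk).2]
  rw [Finset.sum_congr rfl h1]
  refine (sum_min_sub_card (fiber p f y) s _).trans ?_
  apply min_eq_right
  calc ∑ j ∈ fiber p f y, (m j).sample.countP P
      ≤ ∑ j ∈ fiber p f y, s :=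
        Finset.sum_le_sum fun j _ => List.countP_le_length.trans (hm j).2.le
    _ = _ := by simp

end Exchange

/-! ### Correctness of the network -/

section Network

variable {α : Type*} [LinearOrder α] {p : ℕ}

theorem isKernel_pairs (mask : ℕ) : IsKernel (pairs mask) fun i => min i (i ^^^ mask) := by
  intro i j
  have hinv : ∀ a, a ^^^ mask ^^^ mask = a := fun a => by simp
  simp only [pairs, decide_eq_true_eq]
  constructor
  · rintro (rfl | rfl)
    · rfl
    · rw [hinv, min_comm]
  · intro h
    rcases min_choice i (i ^^^ mask) with h1 | h1 <;> rcases min_choice j (j ^^^ mask) with h2 | h2 <;>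
      rw [h1, h2] at h
    · exact Or.inl h.symm
    · rw [h, hinv]; exact Or.inr rfl
    · exact Or.inr h.symm
    · rw [← hinv i, h, hinv]; exact Or.inl rfl

theorem isKernel_blocks (d : ℕ) : IsKernel (blocks d) fun i => i / 2 ^ d := by
  intro i j
  simp [blocks, eq_comm]

theorem mem_fiber_pairs {mask : ℕ} {k j : Fin p} :
    j ∈ fiber p (fun i => min i (i ^^^ mask)) (min (k : ℕ) (k ^^^ mask)) ↔
      (j : ℕ) = k ∨ (j : ℕ) = k ^^^ mask := by
  have := isKernel_pairs mask k j
  simp only [pairs, decide_eq_true_eq] at this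
  rw [mem_fiber, this, eq_comm]

variable {s : ℕ} {m : Fin p → Mem α p} {P : WithTop α → Bool}

/-- Merge-split operations on the real blocks act on the counts as if the missing blocks, filled with
maximum keys, took part. -/
theorem HasBlocks.isPairStep (hm : HasBlocks s m) (hP : IsThreshold P) (mask : ℕ) :
    IsPairStep s mask (belowCount P m) (belowCount P ((exchange s (pairs mask)).run m)) := by
  intro i
  have hle := hm.belowCount_le P
  rcases Nat.lt_or_ge i p with hi | hi
  · obtain ⟨k, rfl⟩ : ∃ k : Fin p, (k : ℕ) = i := ⟨⟨i, hi⟩, rfl⟩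
    rw [belowCount_val, countP_exchange (isKernel_pairs mask) hm hP, belowCount_val]
    have hk := (List.countP_le_length (p := P)).trans (hm k).2.le
    rcases Nat.lt_or_ge ((k : ℕ) ^^^ mask) p with hj | hj
    · obtain ⟨j, hj'⟩ : ∃ j : Fin p, (j : ℕ) = k ^^^ mask := ⟨⟨_, hj⟩, rfl⟩
      have hf : fiber p (fun i => min i (i ^^^ mask)) (min (k : ℕ) (k ^^^ mask)) = {k, j} := by
        ext a
        rw [mem_fiber_pairs, ← hj']
        simp [Fin.ext_iff]
      rw [hf, ← hj', belowCount_val]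
      constructor <;> intro h
      · have hne : k ≠ j := fun h' => by rw [h'] at h; exact lt_irrefl _ h
        have h0 : ({k, j} : Finset (Fin p)).filter (· < k) = ∅ := by
          ext a
          simp only [Finset.mem_filter, Finset.mem_insert, Finset.mem_singleton, Finset.notMem_empty,
            iff_false]
          rintro ⟨rfl | rfl, h'⟩
          · exact lt_irrefl _ h'
          · exact lt_asymm h h'
        rw [Finset.sum_pair hne, h0]
        simp
      · have hne : k ≠ j := fun h' => by rw [h'] at h; exact lt_irrefl _ h
        have h1 : ({k, j} : Finset (Fin p)).filter (· < k) = {j} := by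
          ext a
          simp only [Finset.mem_filter, Finset.mem_insert, Finset.mem_singleton]
          constructor
          · rintro ⟨rfl | rfl, h'⟩
            · exact absurd h' (lt_irrefl _)
            · rfl
          · rintro rfl
            exact ⟨Or.inr rfl, h⟩
        have hj2 := (List.countP_le_length (p := P)).trans (hm j).2.le
        rw [Finset.sum_pair hne, h1, Finset.card_singleton, one_mul]
        omega
    · have hf : fiber p (fun i => min i (i ^^^ mask)) (min (k : ℕ) (k ^^^ mask)) = {k} := by
        ext a
        rw [mem_fiber_pairs, Finset.mem_singleton, Fin.ext_iff, or_iff_left]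
        omega
      rw [hf, belowCount_of_le P m hj]
      constructor <;> intro h
      · have h0 : ({k} : Finset (Fin p)).filter (· < k) = ∅ := by
          ext a
          simp only [Finset.mem_filter, Finset.mem_singleton, Finset.notMem_empty, iff_false]
          rintro ⟨rfl, h'⟩
          exact lt_irrefl _ h'
        rw [h0]
        simp
      · omega
  · rw [belowCount_of_le P _ hi, belowCount_of_le P m hi]
    have := hle (i ^^^ mask)
    constructor <;> intro h
    · rw [belowCount_of_le P m (by omega)]
      simp
    · omega

theorem HasBlocks.isBlockStep (hs : 0 < s) (hm : HasBlocks s m) (hP : IsThreshold P) (d : ℕ) :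
    IsBlockStep s d (belowCount P m) (belowCount P ((exchange s (blocks d)).run m)) := by
  have hval : ∀ k : Fin p, belowCount P ((exchange s (blocks d)).run m) k =
      min s ((∑ j ∈ fiber p (fun i => i / 2 ^ d) (k / 2 ^ d), belowCount P m j) -
        ((fiber p (fun i => i / 2 ^ d) (k / 2 ^ d)).filter (· < k)).card * s) := fun k => by
    simp only [belowCount_val]
    exact countP_exchange (isKernel_blocks d) hm hP k
  refine ⟨?_, ?_, ?_⟩
  · intro k hk
    rcases Nat.lt_or_ge k p with hkp | hkp
    · obtain ⟨k, rfl⟩ : ∃ a : Fin p, (a : ℕ) = k := ⟨⟨k, hkp⟩, rfl⟩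
      by_contra! hcon
      have h1 : (fiber p (fun i => i / 2 ^ d) (k / 2 ^ d)).card * s ≤
          ∑ j ∈ fiber p (fun i => i / 2 ^ d) (k / 2 ^ d), belowCount P m j := by
        rw [← smul_eq_mul]
        exact Finset.card_nsmul_le_sum _ _ _ fun j hj => hcon j (mem_fiber.1 hj)
      have h2 := card_before_lt (f := fun i => i / 2 ^ d) k
      have h3 := Nat.mul_le_mul_right s (Nat.succ_le_of_lt h2)
      rw [Nat.succ_mul] at h3
      rw [hval] at hk
      omega
    · exact ⟨k, rfl, by rw [belowCount_of_le P m hkp]; exact hs⟩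
  · intro k hk
    rcases Nat.lt_or_ge k p with hkp | hkp
    · obtain ⟨k, rfl⟩ : ∃ a : Fin p, (a : ℕ) = k := ⟨⟨k, hkp⟩, rfl⟩
      by_contra! hcon
      have h0 : ∑ j ∈ fiber p (fun i => i / 2 ^ d) (k / 2 ^ d), belowCount P m j = 0 :=
        Finset.sum_eq_zero fun j hj => Nat.le_zero.1 (hcon j (mem_fiber.1 hj))
      rw [hval, h0] at hk
      simp at hk
    · rw [belowCount_of_le P _ hkp] at hk
      omega
  · intro i k hik hlt
    rcases Nat.lt_or_ge k p with hkp | hkp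
    · obtain ⟨i, rfl⟩ : ∃ a : Fin p, (a : ℕ) = i := ⟨⟨i, hlt.trans hkp⟩, rfl⟩
      obtain ⟨k, rfl⟩ : ∃ a : Fin p, (a : ℕ) = k := ⟨⟨k, hkp⟩, rfl⟩
      rw [hval, hval, hik]
      have h2 : ((fiber p (fun i => i / 2 ^ d) (k / 2 ^ d)).filter (· < i)).card <
          ((fiber p (fun i => i / 2 ^ d) (k / 2 ^ d)).filter (· < k)).card := by
        refine Finset.card_lt_card ((Finset.ssubset_iff_of_subset ?_).2
          ⟨i, by simpa using ⟨hik, hlt⟩, by simp⟩)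
        exact Finset.monotone_filter_right _ fun a _ (h : a < i) => h.trans hlt
      have h3 := Nat.mul_le_mul_right s (Nat.succ_le_of_lt h2)
      rw [Nat.succ_mul] at h3
      omega
    · exact Or.inr (belowCount_of_le P _ hkp)

/-- The memories after a program. -/
def runAll {M W : Type*} (l : List (Superstep p M W)) (m : Fin p → M) : Fin p → M :=
  l.foldl (fun m S => S.run m) m

@[simp]
theorem runAll_nil {M W : Type*} (m : Fin p → M) :
    runAll ([] : List (Superstep p M W)) m = m := rfl

@[simp]
theorem runAll_cons {M W : Type*} (S : Superstep p M W) (l : List (Superstep p M W))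
    (m : Fin p → M) : runAll (S :: l) m = runAll l (S.run m) := rfl

theorem runAll_append {M W : Type*} (l₁ l₂ : List (Superstep p M W)) (m : Fin p → M) :
    runAll (l₁ ++ l₂) m = runAll l₂ (runAll l₁ m) := List.foldl_append

theorem HasBlocks.runAll_exchange (hm : HasBlocks s m) {l : List (ℕ → ℕ → Bool)}
    (hl : ∀ R ∈ l, ∃ f, IsKernel R f) : HasBlocks s (runAll (l.map (exchange s)) m) := by
  induction l generalizing m with
  | nil => exact hm
  | cons R l ih =>
    obtain ⟨f, hf⟩ := hl R (by simp)
    exact ih (hm.run_exchange hf) fun R' h => hl R' (by simp [h])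

theorem sum_countP_runAll (hm : HasBlocks s m) (hP : IsThreshold P) {l : List (ℕ → ℕ → Bool)}
    (hl : ∀ R ∈ l, ∃ f, IsKernel R f) :
    ∑ k, (runAll (l.map (exchange s)) m k).sample.countP P = ∑ k, (m k).sample.countP P := by
  induction l generalizing m with
  | nil => rfl
  | cons R l ih =>
    obtain ⟨f, hf⟩ := hl R (by simp)
    rw [List.map_cons, runAll_cons, ih (hm.run_exchange hf) fun R' h => hl R' (by simp [h]),
      sum_countP_exchange hf hm hP]

theorem keys_runAll (l : List (ℕ → ℕ → Bool)) (k : Fin p) :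
    (runAll (l.map (exchange s)) m k).keys = (m k).keys := by
  induction l generalizing m with
  | nil => rfl
  | cons R l ih => exact ih

/-- The half-cleaners of a merge, which act on blocks at distances `2 ^ (d + t - 1)`, ...,
`2 ^ d`. -/
theorem separated_cleaners (hs : 0 < s) (hP : IsThreshold P) {d M : ℕ} (t : ℕ)
    (hm : HasBlocks s m) (hM : d + t ≤ M) (hsep : Separated s M (d + t) (belowCount P m))
    (hbit : Bitonic s (d + t) (belowCount P m)) :
    HasBlocks s (runAll ((((List.range' d t).reverse.map fun j => pairs (2 ^ j))).map (exchange s)) m) ∧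
    Separated s M d (belowCount P
      (runAll ((((List.range' d t).reverse.map fun j => pairs (2 ^ j))).map (exchange s)) m)) := by
  induction t generalizing m with
  | zero => exact ⟨hm, hsep⟩
  | succ t ih =>
    rw [List.range'_1_concat, List.reverse_append, List.reverse_singleton, List.singleton_append,
      List.map_cons, List.map_cons, runAll_cons]
    obtain ⟨h1, h2⟩ := (hm.isPairStep hP (2 ^ (d + t))).clean hs (hm.belowCount_le P)
      (by omega) hsep hbit
    exact ih (hm.run_exchange (isKernel_pairs _)) (by omega) h1 h2

theorem eq_of_mem_bitonicRounds {d q : ℕ} {R : ℕ → ℕ → Bool} (hR : R ∈ bitonicRounds d q) :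
    (∃ mask, R = pairs mask) ∨ R = blocks d := by
  simp only [bitonicRounds, List.mem_cons, List.mem_flatMap, List.mem_append, List.mem_map,
    List.not_mem_nil, or_false] at hR
  rcases hR with h | ⟨_, _, (h | ⟨_, _, h⟩) | h⟩
  · exact Or.inr h
  · exact Or.inl ⟨_, h⟩
  · exact Or.inl ⟨_, h.symm⟩
  · exact Or.inr h

/-- The levels of merge number `m` of the network. -/
def mergeRounds (d m : ℕ) : List (ℕ → ℕ → Bool) :=
  [pairs (2 ^ m - 1)] ++ ((List.range' d (m - 1 - d)).reverse.map fun j => pairs (2 ^ j)) ++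
    [blocks d]

theorem bitonicRounds_eq (d q : ℕ) : bitonicRounds d q =
    blocks d :: (List.range' (d + 1) (Nat.clog 2 q - d)).flatMap (mergeRounds d) := rfl

theorem separated_merges (hs : 0 < s) (hP : IsThreshold P) {d : ℕ} (t : ℕ)
    (hm : HasBlocks s m) (hsep : Separated s d 0 (belowCount P m)) :
    HasBlocks s (runAll (((List.range' (d + 1) t).flatMap (mergeRounds d)).map (exchange s)) m) ∧
    Separated s (d + t) 0 (belowCount P
      (runAll (((List.range' (d + 1) t).flatMap (mergeRounds d)).map (exchange s)) m)) := by
  induction t with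
  | zero => exact ⟨hm, hsep⟩
  | succ t ih =>
    rw [List.range'_1_concat, List.flatMap_append, List.map_append, runAll_append]
    generalize runAll (((List.range' (d + 1) t).flatMap (mergeRounds d)).map (exchange s)) m = m₁
      at ih ⊢
    obtain ⟨hm₁, hsep₁⟩ := ih
    have e1 : d + 1 + t - 1 - d = t := by omega
    have e2 : d + 1 + t = d + t + 1 := by omega
    rw [List.flatMap_singleton, mergeRounds, e1, e2]
    simp only [List.cons_append, List.nil_append, List.map_cons, List.map_append, List.map_nil,
      runAll_cons, runAll_append, runAll_nil]
    obtain ⟨h1, h2⟩ := (hm₁.isPairStep hP (2 ^ (d + t + 1) - 1)).mirror (hm₁.belowCount_le P) hsep₁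
    obtain ⟨h3, h4⟩ := separated_cleaners hs hP t (hm₁.run_exchange (isKernel_pairs _))
      (Nat.le_succ _) h1 h2
    have h5 := h3.run_exchange (isKernel_blocks d)
    exact ⟨h5, (h3.isBlockStep hs hP d).separated (h5.belowCount_le P) (by omega) h4⟩

/-- The bitonic network sorts the blocks of the processors. -/
theorem bitonicRounds_sorted (hs : 0 < s) (hm : HasBlocks s m) (hP : IsThreshold P) (d : ℕ)
    {i k : Fin p} (hik : i < k) :
    (runAll ((bitonicRounds d p).map (exchange s)) m i).sample.countP P = s ∨
      (runAll ((bitonicRounds d p).map (exchange s)) m k).sample.countP P = 0 := by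
  have h1 := hm.run_exchange (isKernel_blocks d)
  have h2 := (hm.isBlockStep hs hP d).separated (h1.belowCount_le P) le_rfl (separated_self _ _ _)
  obtain ⟨_, h3⟩ := separated_merges hs hP (Nat.clog 2 p - d) h1 h2
  have hp : p ≤ 2 ^ (d + (Nat.clog 2 p - d)) :=
    (Nat.le_pow_clog one_lt_two p).trans (Nat.pow_le_pow_right two_pos (by omega))
  rw [bitonicRounds_eq, List.map_cons, runAll_cons]
  have := h3 i k (by rw [Nat.div_eq_of_lt (by omega), Nat.div_eq_of_lt (by omega)]) (by simpa using hik)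
  simpa only [belowCount_val] using this

end Network

/-! ### Regular oversampling -/

section Sampling

theorem add_le_mul_add_one {p x : ℕ} (hx : 0 < x) (hp : 2 ≤ p) : p + x ≤ p * x + 1 := by
  obtain ⟨a, rfl⟩ := Nat.exists_eq_add_of_lt hx
  obtain ⟨b, rfl⟩ := Nat.exists_eq_add_of_le hp
  nlinarith [Nat.zero_le (a * b)]

theorem countP_lt_range (s b : ℕ) : (List.range s).countP (fun j => decide (j < b)) = min s b := by
  induction s with
  | zero => simp
  | succ s ih =>
    rw [List.range_succ, List.countP_append, ih, List.countP_singleton]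
    by_cases h : s < b
    · simp only [h, decide_true, if_true]; omega
    · simp only [h, decide_false]; simp; omega

variable {α : Type*} [LinearOrder α] {p : ℕ}

theorem getD_iff_lt_countP {P : WithTop α → Bool} (hP : IsThreshold P) (htop : ¬P ⊤ = true)
    {Y : List (WithTop α)} (hY : Y.Pairwise (· ≤ ·)) (i : ℕ) :
    P (Y.getD i ⊤) = true ↔ i < Y.countP P := by
  rcases Nat.lt_or_ge i Y.length with h | h
  · rw [List.getD_eq_getElem _ _ h, getElem_iff_lt_countP hP hY i h]
  · rw [List.getD_eq_default _ _ h]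
    have : Y.countP P ≤ Y.length := List.countP_le_length
    exact ⟨fun h' => absurd h' htop, fun h' => by omega⟩

/-- If `c` keys of a sorted sequence are below a threshold, then so are `c / x` of the keys of rank
`x`, `2 x`, ..., `s x` of the padded sequence. -/
theorem countP_sample {P : WithTop α → Bool} (hP : IsThreshold P) (htop : ¬P ⊤ = true)
    {Y : List (WithTop α)} (hY : Y.Pairwise (· ≤ ·)) {s x : ℕ} (hx : 0 < x)
    (hlen : Y.length ≤ s * x) :
    ((List.range s).map fun j => Y.getD ((j + 1) * x - 1) ⊤).countP P = Y.countP P / x := by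
  have hc : Y.countP P / x ≤ s :=
    Nat.div_le_of_le_mul (by rw [mul_comm]; exact List.countP_le_length.trans hlen)
  rw [List.countP_map, ← min_eq_right hc, ← countP_lt_range]
  refine List.countP_congr fun j _ => ?_
  rw [Function.comp_apply, getD_iff_lt_countP hP htop hY, decide_eq_true_eq, Nat.lt_iff_add_one_le,
    Nat.lt_iff_add_one_le, Nat.le_div_iff_mul_le hx]
  have : 0 < (j + 1) * x := by positivity
  omega

theorem sample_pairwise {Y : List (WithTop α)} (hY : Y.Pairwise (· ≤ ·)) (s x : ℕ) :
    ((List.range s).map fun j => Y.getD ((j + 1) * x - 1) ⊤).Pairwise (· ≤ ·) := by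
  rw [List.pairwise_map]
  refine List.pairwise_lt_range.imp fun {i j} hij => ?_
  have hle : (i + 1) * x - 1 ≤ (j + 1) * x - 1 :=
    Nat.sub_le_sub_right (Nat.mul_le_mul_right _ (by omega)) _
  rcases Nat.lt_or_ge ((j + 1) * x - 1) Y.length with h | h
  · rw [List.getD_eq_getElem _ _ h, List.getD_eq_getElem _ _ (hle.trans_lt h)]
    rcases hle.eq_or_lt with h' | h'
    · simp [h']
    · exact List.pairwise_iff_getElem.1 hY _ _ _ _ h'
  · rw [List.getD_eq_default _ _ h]
    exact le_top

/-- The processors hold sorted sequences `Y k` of distinct keys, and the blocks `T k` hold the sorted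
sample, which was formed with segments of `x` keys. The order of the blocks and their relation to
the keys are expressed by thresholds. -/
structure IsSortedSample (s x : ℕ) (Y T : Fin p → List (WithTop α)) : Prop where
  keys_length : ∀ k, (Y k).length ≤ s * x
  keys_distinct : ∀ a, ∑ k, (Y k).countP (fun b => decide (b = a)) ≤ 1
  block_length : ∀ k, (T k).length = s
  block_pairwise : ∀ k, (T k).Pairwise (· ≤ ·)
  sorted : ∀ P, IsThreshold P → ∀ i k, i < k → (T i).countP P = s ∨ (T k).countP P = 0
  sum_countP : ∀ P, IsThreshold P → ¬P ⊤ = true →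
    ∑ k, (T k).countP P = ∑ k, (Y k).countP P / x

/-- The last key of a block. -/
def lastKey (T : Fin p → List (WithTop α)) (k : Fin p) : WithTop α := (T k).getLastD ⊤

namespace IsSortedSample

variable {s x : ℕ} {Y T : Fin p → List (WithTop α)} (h : IsSortedSample s x Y T)
include h

theorem lastKey_mem (hs : 0 < s) (k : Fin p) : lastKey T k ∈ T k := by
  have hne : T k ≠ [] := fun h0 => by
    have := h.block_length k
    rw [h0] at this
    simp at this
    omega
  rw [lastKey, List.getLastD_eq_getLast?, List.getLast?_eq_some_getLast hne]
  exact List.getLast_mem hne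

theorem le_lastKey (hs : 0 < s) (k : Fin p) : ∀ a ∈ T k, a ≤ lastKey T k := by
  have hne : T k ≠ [] := List.ne_nil_of_mem (h.lastKey_mem hs k)
  intro a ha
  rw [lastKey, List.getLastD_eq_getLast?, List.getLast?_eq_some_getLast hne, Option.getD_some]
  exact (h.block_pairwise k).rel_getLast ha

theorem countP_le_lastKey_self (hs : 0 < s) (k : Fin p) :
    (T k).countP (fun b => decide (b ≤ lastKey T k)) = s := by
  rw [← h.block_length k, List.countP_eq_length]
  exact fun a ha => by simpa using h.le_lastKey hs k a ha

theorem countP_le_lastKey (hs : 0 < s) {i k : Fin p} (hik : i ≤ k) :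
    (T i).countP (fun b => decide (b ≤ lastKey T k)) = s := by
  rcases hik.eq_or_lt with rfl | hik
  · exact h.countP_le_lastKey_self hs i
  · have := h.countP_le_lastKey_self hs k
    rcases h.sorted _ (isThreshold_le (lastKey T k)) i k hik with h' | h'
    · exact h'
    · omega

theorem lastKey_mono (hs : 0 < s) {i k : Fin p} (hik : i ≤ k) : lastKey T i ≤ lastKey T k := by
  have h1 := h.countP_le_lastKey hs hik
  rw [← h.block_length i, List.countP_eq_length] at h1
  simpa using h1 _ (h.lastKey_mem hs i)

theorem le_sum_countP_le (hs : 0 < s) (k : Fin p) :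
    (k + 1) * s ≤ ∑ i, (T i).countP (fun b => decide (b ≤ lastKey T k)) := by
  calc (k + 1) * s = ∑ i ∈ Finset.Iic k, s := by simp
    _ = ∑ i ∈ Finset.Iic k, (T i).countP (fun b => decide (b ≤ lastKey T k)) :=
        Finset.sum_congr rfl fun i hi => (h.countP_le_lastKey hs (Finset.mem_Iic.1 hi)).symm
    _ ≤ _ := Finset.sum_le_sum_of_subset (Finset.subset_univ _)

theorem sum_countP_lt (hs : 0 < s) (k : Fin p) :
    ∑ i, (T i).countP (fun b => decide (b < lastKey T k)) + 1 ≤ (k + 1) * s := by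
  have hk : (T k).countP (fun b => decide (b < lastKey T k)) < s := by
    rw [← h.block_length k]
    refine lt_of_le_of_ne List.countP_le_length fun h' => ?_
    rw [List.countP_eq_length] at h'
    have := h' _ (h.lastKey_mem hs k)
    simp at this
  have h0 : ∑ i, (T i).countP (fun b => decide (b < lastKey T k)) =
      ∑ i ∈ Finset.Iic k, (T i).countP (fun b => decide (b < lastKey T k)) := by
    refine (Finset.sum_subset (Finset.subset_univ _) fun i _ hi => ?_).symm
    rw [Finset.mem_Iic, not_le] at hi
    rcases h.sorted _ (isThreshold_lt (lastKey T k)) k i hi with h' | h'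
    · omega
    · exact h'
  rw [h0]
  calc ∑ i ∈ Finset.Iic k, (T i).countP (fun b => decide (b < lastKey T k)) + 1
      ≤ ∑ i ∈ Finset.Iic k, s :=
        Finset.sum_lt_sum (fun i _ => List.countP_le_length.trans (h.block_length i).le)
          ⟨k, by simp, hk⟩
    _ = (k + 1) * s := by simp

/-- At least `(k + 1) s x` keys are at most the splitter that ends block `k`. -/
theorem le_sum_keys_le (hs : 0 < s) (k : Fin p) (htop : lastKey T k ≠ ⊤) :
    (k + 1) * s * x ≤ ∑ i, (Y i).countP (fun b => decide (b ≤ lastKey T k)) := by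
  have h1 := h.le_sum_countP_le hs k
  rw [h.sum_countP _ (isThreshold_le _) (by simpa using htop)] at h1
  calc (k + 1) * s * x ≤ (∑ i, (Y i).countP (fun b => decide (b ≤ lastKey T k)) / x) * x :=
        Nat.mul_le_mul_right _ h1
    _ = ∑ i, (Y i).countP (fun b => decide (b ≤ lastKey T k)) / x * x := Finset.sum_mul _ _ _
    _ ≤ _ := Finset.sum_le_sum fun i _ => Nat.div_mul_le_self _ _

/-- Fewer than `(k + 1) s` sample keys are below the splitter that ends block `k`, and every
processor has fewer than `x` keys between its last sample key below the splitter and the splitter;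
at most one key equals the splitter. -/
theorem sum_keys_le (hs : 0 < s) (hx : 0 < x) (k : Fin p) :
    ∑ i, (Y i).countP (fun b => decide (b ≤ lastKey T k)) + p + x ≤
      (k + 1) * s * x + p * x + 1 := by
  have h1 := h.sum_countP_lt hs k
  rw [h.sum_countP _ (isThreshold_lt _) (by simp)] at h1
  have h2 : ∀ i, (Y i).countP (fun b => decide (b ≤ lastKey T k)) =
      (Y i).countP (fun b => decide (b < lastKey T k)) +
        (Y i).countP (fun b => decide (b = lastKey T k)) := by
    intro i
    induction Y i with
    | nil => rfl
    | cons a l ih =>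
      simp only [List.countP_cons, ih, decide_eq_true_eq]
      rcases lt_trichotomy a (lastKey T k) with h' | h' | h'
      · simp only [h', h'.le, h'.ne, if_true, if_false]; omega
      · simp only [h', le_refl, lt_irrefl, if_true, if_false]; omega
      · simp only [h'.not_ge, h'.not_gt, h'.ne', if_false]; omega
  have h3 : ∑ i, ((Y i).countP (fun b => decide (b < lastKey T k)) + 1) ≤
      ∑ i, ((Y i).countP (fun b => decide (b < lastKey T k)) / x * x + x) := by
    refine Finset.sum_le_sum fun i _ => ?_
    have e1 := Nat.div_add_mod' ((Y i).countP (fun b => decide (b < lastKey T k))) x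
    have e2 := Nat.mod_lt ((Y i).countP (fun b => decide (b < lastKey T k))) hx
    omega
  have h4 := h.keys_distinct (lastKey T k)
  have h5 := Nat.mul_le_mul_right x h1
  simp only [h2, Finset.sum_add_distrib, ← Finset.sum_mul, Finset.sum_const, Finset.card_univ,
    Fintype.card_fin, smul_eq_mul, mul_one, add_mul, one_mul] at h3 h5 ⊢
  omega

end IsSortedSample

/-- The boundaries of the subsequences of the sorted sequence `Y k` that are cut at the splitters. -/
structure IsCut (Y T : Fin p → List (WithTop α)) (cut : Fin p → ℕ → ℕ) : Prop where
  zero : ∀ k, cut k 0 = 0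
  mid : ∀ k (j : Fin p), (j : ℕ) + 1 < p →
    cut k (j + 1) = (Y k).countP fun b => decide (b ≤ lastKey T j)
  last : ∀ k, cut k p = (Y k).length

namespace IsCut

variable {s x : ℕ} {Y T : Fin p → List (WithTop α)} {cut : Fin p → ℕ → ℕ}

theorem mono (hc : IsCut Y T cut) (h : IsSortedSample s x Y T) (hs : 0 < s) (k : Fin p) {i : ℕ}
    (hi : i < p) : cut k i ≤ cut k (i + 1) := by
  rcases i with - | i
  · rw [hc.zero]; exact Nat.zero_le _
  · rw [hc.mid k ⟨i, by omega⟩ hi]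
    rcases Nat.lt_or_ge (i + 1 + 1) p with h' | h'
    · rw [hc.mid k ⟨i + 1, hi⟩ h']
      refine List.countP_mono_left fun a _ ha => ?_
      simp only [decide_eq_true_eq] at ha ⊢
      exact ha.trans (h.lastKey_mono hs (Fin.mk_le_mk.2 (Nat.le_succ i)))
    · rw [show i + 1 + 1 = p by omega, hc.last]
      exact List.countP_le_length

/-- The number of keys that processor `i` receives. -/
theorem bucket_le (hc : IsCut Y T cut) (h : IsSortedSample s x Y T) (hs : 0 < s) (hx : 0 < x)
    (hp : 2 ≤ p) {i : ℕ} (hi : i < p) :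
    ∑ k, (cut k (i + 1) - cut k i) + p + x ≤ s * x + p * x + 1 := by
  have hsum : ∑ k, (cut k (i + 1) - cut k i) + ∑ k, cut k i = ∑ k, cut k (i + 1) := by
    rw [← Finset.sum_add_distrib]
    exact Finset.sum_congr rfl fun k _ => Nat.sub_add_cancel (hc.mono h hs k hi)
  have hpx := add_le_mul_add_one hx hp
  by_cases htop : ∃ j : Fin p, (j : ℕ) + 1 = i ∧ lastKey T j = ⊤
  · -- no key exceeds the preceding splitter
    obtain ⟨j, rfl, htop⟩ := htop
    have : ∑ k, (cut k (j + 1 + 1) - cut k (j + 1)) = 0 := by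
      refine Finset.sum_eq_zero fun k _ => ?_
      have h1 : cut k (j + 1) = (Y k).length := by
        rw [hc.mid k j hi, htop, List.countP_eq_length]
        simp
      have h2 : cut k (j + 1 + 1) ≤ (Y k).length := by
        rcases Nat.lt_or_ge ((j : ℕ) + 1 + 1) p with h' | h'
        · rw [hc.mid k ⟨j + 1, hi⟩ h']
          exact List.countP_le_length
        · rw [show (j : ℕ) + 1 + 1 = p by omega, hc.last]
      omega
    rw [this]
    omega
  · have hlow : i * s * x ≤ ∑ k, cut k i := by
      rcases i with - | i
      · simp
      · have := h.le_sum_keys_le hs ⟨i, by omega⟩ fun h' => htop ⟨⟨i, by omega⟩, rfl, h'⟩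
        simpa only [hc.mid _ ⟨i, by omega⟩ hi] using this
    rcases Nat.lt_or_ge (i + 1) p with h' | h'
    · have hup := h.sum_keys_le hs hx ⟨i, hi⟩
      simp only [← hc.mid _ ⟨i, hi⟩ h'] at hup
      rw [add_mul, add_mul, one_mul] at hup
      omega
    · -- the last sample key of a processor is its maximum
      have hup : ∑ k, cut k (i + 1) ≤ p * (s * x) := by
        calc ∑ k, cut k (i + 1) ≤ ∑ k : Fin p, s * x := by
              refine Finset.sum_le_sum fun k _ => ?_
              rw [show i + 1 = p by omega, hc.last]
              exact h.keys_length k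
          _ = _ := by simp
      have h2 : p * (s * x) = i * s * x + s * x := by
        rw [show p = i + 1 by omega]; ring
      omega

/-- A processor sends each of its keys once. -/
theorem sum_sub (hc : IsCut Y T cut) (h : IsSortedSample s x Y T) (hs : 0 < s) (k : Fin p) :
    ∑ i : Fin p, (cut k (i + 1) - cut k i) = (Y k).length := by
  have : ∀ q, q ≤ p → ∑ i ∈ Finset.range q, (cut k (i + 1) - cut k i) = cut k q := by
    intro q hq
    induction q with
    | zero => simp [hc.zero]
    | succ q ih =>
      rw [Finset.sum_range_succ, ih (by omega)]
      have := hc.mono h hs k (show q < p by omega)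
      omega
  rw [Fin.sum_univ_eq_sum_range fun i => cut k (i + 1) - cut k i, this p le_rfl, hc.last]

end IsCut

end Sampling

/-! ### The supersteps of the algorithm -/

section Supersteps

variable {α : Type*} {p : ℕ}

/-- The splitters received by a processor, in order. -/
theorem getD_splitters {T : Fin p → List (WithTop α)} (hT : ∀ k, T k ≠ []) {j : Fin p}
    (hj : (j : ℕ) + 1 < p) :
    ((List.finRange p).flatMap fun i : Fin p =>
      keysOf (if (i : ℕ) + 1 < p then (T i).getLast?.toList.map (Sum.inl : _ → Word α) else [])).getD
        j ⊤ = lastKey T j := by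
  obtain ⟨q, rfl⟩ : ∃ q, p = q + 1 := ⟨p - 1, by omega⟩
  have h1 : ∀ i : Fin q, keysOf (if ((i.castSucc : Fin (q + 1)) : ℕ) + 1 < q + 1 then
      (T i.castSucc).getLast?.toList.map (Sum.inl : _ → Word α) else []) =
      [lastKey T i.castSucc] := by
    intro i
    rw [if_pos (by simp), keysOf_map_inl, lastKey, List.getLastD_eq_getLast?,
      List.getLast?_eq_some_getLast (hT _)]
    rfl
  rw [List.finRange_succ_last, List.flatMap_append, List.flatMap_map]
  simp only [h1]
  rw [← List.map_eq_flatMap, List.flatMap_singleton, if_neg (by simp)]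
  have hjq : (j : ℕ) < q := by omega
  simp only [keysOf, List.filterMap_nil, List.append_nil]
  rw [List.getD_eq_getElem _ _ (by simpa using hjq)]
  simp

variable [LinearOrder α]

/-- The local memories of the algorithm after the sample has been sorted. -/
noncomputable def sortedMem (d s x : ℕ) (X : Fin p → List α) : Fin p → Mem α p :=
  runAll ((bitonicRounds d p).map (exchange s)) ((localSort s x).run (initialMem X))

theorem keys_initialMem {α : Type*} {p : ℕ} (X : Fin p → List α) (k : Fin p) :
    (initialMem X k).keys = (X k).map WithTop.some := by
  rw [List.map_eq_flatMap]
  exact List.map_id _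

theorem keys_localSort (s x : ℕ) (X : Fin p → List α) (k : Fin p) :
    ((localSort s x).run (initialMem X) k).keys =
      ((X k).map WithTop.some).mergeSort (fun a b => decide (a ≤ b)) := by
  rw [← keys_initialMem]
  rfl

theorem sample_localSort (s x : ℕ) (X : Fin p → List α) (k : Fin p) :
    ((localSort s x).run (initialMem X) k).sample =
      (List.range s).map fun j =>
        ((localSort s x).run (initialMem X) k).keys.getD ((j + 1) * x - 1) ⊤ := rfl

theorem hasBlocks_localSort (s x : ℕ) (X : Fin p → List α) :
    HasBlocks s ((localSort s x).run (initialMem X)) := by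
  intro k
  rw [sample_localSort, keys_localSort]
  exact ⟨sample_pairwise (mergeSort_pairwise _) s x, by simp⟩

theorem exists_isKernel {d : ℕ} {R : ℕ → ℕ → Bool} (hR : R ∈ bitonicRounds d p) :
    ∃ f, IsKernel R f := by
  rcases eq_of_mem_bitonicRounds hR with ⟨mask, rfl⟩ | rfl
  · exact ⟨_, isKernel_pairs mask⟩
  · exact ⟨_, isKernel_blocks d⟩

theorem IsInput.sum_countP_le {n : ℕ} {X : Fin p → List α} (hX : IsInput n X) (a : WithTop α) :
    ∑ k, ((X k).map WithTop.some).countP (fun b => decide (b = a)) ≤ 1 := by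
  have h := hX.distinct.map (f := (WithTop.some : α → WithTop α)) WithTop.coe_injective
  rw [List.map_flatten, List.map_ofFn] at h
  have h' := List.nodup_iff_count_le_one.1 h a
  rw [List.count_flatten, List.map_ofFn, List.sum_ofFn] at h'
  refine le_trans (Finset.sum_le_sum fun k _ => ?_) h'
  rw [Function.comp_apply, Function.comp_apply, List.count_eq_countP]
  exact le_of_eq (List.countP_congr fun b _ => by simp)

theorem IsInput.isSortedSample {n s x d : ℕ} {X : Fin p → List α} (hX : IsInput n X) (hs : 0 < s)
    (hx : 0 < x) (hlen : n ⌈/⌉ p ≤ s * x) :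
    IsSortedSample s x (fun k => (sortedMem d s x X k).keys)
      (fun k => (sortedMem d s x X k).sample) := by
  have hb := hasBlocks_localSort s x X
  have hb' : HasBlocks s (sortedMem d s x X) := hb.runAll_exchange fun R hR => exists_isKernel hR
  have hkeys : ∀ k, (sortedMem d s x X k).keys =
      ((X k).map WithTop.some).mergeSort (fun a b => decide (a ≤ b)) := fun k => by
    rw [sortedMem, keys_runAll, keys_localSort]
  have hlen' : ∀ k, (((X k).map WithTop.some).mergeSort
      (fun a b => decide (a ≤ b))).length ≤ s * x := fun k => by
    rw [List.length_mergeSort, List.length_map]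
    exact (hX.even k).trans hlen
  refine ⟨fun k => ?_, fun a => ?_, fun k => (hb' k).2, fun k => (hb' k).1,
    fun P hP i k hik => bitonicRounds_sorted hs hb hP d hik, fun P hP htop => ?_⟩
  · rw [hkeys]
    exact hlen' k
  · simp only [hkeys, (List.mergeSort_perm _ _).countP_eq]
    exact hX.sum_countP_le a
  · simp only [hkeys]
    rw [sortedMem, sum_countP_runAll hb hP fun R hR => exists_isKernel hR]
    refine Finset.sum_congr rfl fun k _ => ?_
    rw [sample_localSort, keys_localSort]
    exact countP_sample hP htop (mergeSort_pairwise _) hx (hlen' k)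

theorem isCut_broadcast {s x : ℕ} {m : Fin p → Mem α p} (hs : 0 < s) (hp : 2 ≤ p)
    (h : IsSortedSample s x (fun k => (m k).keys) (fun k => (m k).sample)) :
    IsCut (fun k => (m k).keys) (fun k => (m k).sample) fun k => (broadcast.run m k).cut := by
  refine ⟨fun k => rfl, fun k j hj => ?_, fun k => ?_⟩
  · have h1 := getD_splitters (T := fun k => (m k).sample)
      (fun k => List.ne_nil_of_mem (h.lastKey_mem hs k)) hj
    have h2 : (broadcast.run m k).cut (j + 1) =
        if (j : ℕ) + 1 = 0 then 0 else if (j : ℕ) + 1 < p then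
          (m k).keys.countP (fun b => decide (b ≤ (((List.finRange p).flatMap fun i : Fin p =>
            keysOf (if (i : ℕ) + 1 < p then (m i).sample.getLast?.toList.map
              (Sum.inl : _ → Word α) else [])).getD ((j : ℕ) + 1 - 1) ⊤))) else (m k).keys.length :=
      rfl
    rw [h2, if_neg (by omega), if_pos hj, Nat.add_sub_cancel, h1]
  · have h2 : (broadcast.run m k).cut p =
        if p = 0 then 0 else if p < p then
          (m k).keys.countP (fun b => decide (b ≤ (((List.finRange p).flatMap fun i : Fin p =>
            keysOf (if (i : ℕ) + 1 < p then (m i).sample.getLast?.toList.map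
              (Sum.inl : _ → Word α) else [])).getD (p - 1) ⊤))) else (m k).keys.length :=
      rfl
    rw [h2, if_neg (by omega), if_neg (lt_irrefl _)]

end Supersteps

/-! ### Cost of the supersteps -/

section Costs

variable {α : Type*} {p : ℕ}

theorem lg_nonneg {x : ℝ} (h : 1 ≤ x) : 0 ≤ lg x := Real.logb_nonneg one_lt_two h

theorem lg_le_lg {x y : ℝ} (hx : 0 < x) (h : x ≤ y) : lg x ≤ lg y :=
  Real.logb_le_logb_of_le one_lt_two hx h

theorem lg_two_pow (d : ℕ) : lg (2 ^ d) = d := by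
  rw [lg, Real.logb_pow, Real.logb_self_eq_one one_lt_two, mul_one]

theorem natCast_mul_lg_le {a b : ℕ} (h : a ≤ b) : (a : ℝ) * lg a ≤ b * lg b := by
  rcases Nat.eq_zero_or_pos a with rfl | ha
  · rcases Nat.eq_zero_or_pos b with rfl | hb
    · simp
    · have : 0 ≤ lg (b : ℝ) := lg_nonneg (by exact_mod_cast hb)
      simp only [Nat.cast_zero, zero_mul]
      positivity
  · have h1 : (1 : ℝ) ≤ a := by exact_mod_cast ha
    have h2 : (a : ℝ) ≤ b := by exact_mod_cast h
    exact mul_le_mul h2 (lg_le_lg (by linarith) h2) (lg_nonneg h1) (by positivity)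

theorem compTime_append {M W : Type*} (l₁ l₂ : List (Superstep p M W)) (m : Fin p → M) :
    compTime (l₁ ++ l₂) m = compTime l₁ m + compTime l₂ (runAll l₁ m) := by
  induction l₁ generalizing m with
  | nil => simp [compTime]
  | cons S l ih => simp only [List.cons_append, compTime, ih, runAll_cons, add_assoc]

theorem commTime_append {M W : Type*} (L g : ℝ) (l₁ l₂ : List (Superstep p M W)) (m : Fin p → M) :
    commTime L g (l₁ ++ l₂) m = commTime L g l₁ m + commTime L g l₂ (runAll l₁ m) := by
  induction l₁ generalizing m with
  | nil => simp [commTime]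
  | cons S l ih => simp only [List.cons_append, commTime, ih, runAll_cons, add_assoc]

theorem max_le_add {L g : ℝ} (hL : 0 ≤ L) (hg : 0 ≤ g) {h b : ℕ} (hb : h ≤ b) :
    max L (g * h) ≤ L + g * b := by
  have h1 : g * (h : ℝ) ≤ g * b := mul_le_mul_of_nonneg_left (by exact_mod_cast hb) hg
  have h2 : 0 ≤ g * (h : ℝ) := by positivity
  exact max_le (by linarith) (by linarith)

theorem Superstep.h_le {M W : Type*} (S : Superstep p M W) (m : Fin p → M) {b : ℕ}
    (hsend : ∀ k, ∑ j, (S.send k (m k) j).length ≤ b)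
    (hrecv : ∀ k, ∑ j, (S.send j (m j) k).length ≤ b) : S.h m ≤ b :=
  Finset.sup_le fun k _ => max_le (hsend k) (hrecv k)

theorem prefixSums_cost [Nonempty (Fin p)] (m : Fin p → Mem α p) : prefixSums.x m ≤ p :=
  ciSup_le fun _ => le_rfl

theorem addresses_cost [Nonempty (Fin p)] (m : Fin p → Mem α p) : addresses.x m ≤ p :=
  ciSup_le fun _ => le_rfl

theorem prefixSums_h (m : Fin p → Mem α p) : prefixSums.h m ≤ p :=
  Superstep.h_le _ _ (fun k => by simp [prefixSums]) (fun k => by simp [prefixSums])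

theorem addresses_h (m : Fin p → Mem α p) : addresses.h m ≤ p :=
  Superstep.h_le _ _ (fun k => by simp [addresses]) (fun k => by simp [addresses])

variable [LinearOrder α]

theorem localSort_cost {n : ℕ} {X : Fin p → List α} (hX : IsInput n X) [Nonempty (Fin p)]
    (s x : ℕ) :
    (localSort s x).x (initialMem X) ≤ (n ⌈/⌉ p : ℕ) * lg (n ⌈/⌉ p : ℕ) + 2 * s := by
  refine ciSup_le fun k => ?_
  have h1 : ((localSort s x).exec (initialMem X) k).cost =
      (((X k).map WithTop.some).length : ℝ) *
        lg ((X k).map WithTop.some).length + 2 * s := by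
    rw [← keys_initialMem]
    rfl
  rw [h1, List.length_map]
  have := natCast_mul_lg_le (hX.even k)
  linarith

theorem localSort_h {X : Fin p → List α} (s x : ℕ) : (localSort s x).h (initialMem X) ≤ 0 :=
  Superstep.h_le _ _ (fun k => by simp [localSort]) (fun k => by simp [localSort])

/-- The groups of the supersteps of the network have at most `2 ^ d` members. -/
theorem card_group_le {d : ℕ} (hd : 1 ≤ d) {R : ℕ → ℕ → Bool} (hR : R ∈ bitonicRounds d p) :
    ∃ f, IsKernel R f ∧ ∀ k : Fin p, (fiber p f (f k)).card ≤ 2 ^ d := by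
  rcases eq_of_mem_bitonicRounds hR with ⟨mask, rfl⟩ | rfl
  · refine ⟨_, isKernel_pairs mask, fun k => ?_⟩
    rw [← Finset.card_map Fin.valEmbedding]
    calc _ ≤ ({(k : ℕ), (k : ℕ) ^^^ mask} : Finset ℕ).card := by
          refine Finset.card_le_card fun a ha => ?_
          obtain ⟨j, hj, rfl⟩ := Finset.mem_map.1 ha
          simpa using mem_fiber_pairs.1 hj
      _ ≤ 2 := Finset.card_le_two
      _ ≤ 2 ^ d := by simpa using Nat.pow_le_pow_right two_pos hd
  · refine ⟨_, isKernel_blocks d, fun k => ?_⟩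
    have hpos : 0 < 2 ^ d := by positivity
    rw [← Finset.card_map Fin.valEmbedding]
    calc _ ≤ (Finset.Ico ((k : ℕ) / 2 ^ d * 2 ^ d) ((k : ℕ) / 2 ^ d * 2 ^ d + 2 ^ d)).card := by
          refine Finset.card_le_card fun a ha => ?_
          obtain ⟨j, hj, rfl⟩ := Finset.mem_map.1 ha
          have h1 : (j : ℕ) / 2 ^ d = k / 2 ^ d := mem_fiber.1 hj
          have h2 := Nat.div_add_mod' (j : ℕ) (2 ^ d)
          have h3 := Nat.mod_lt (j : ℕ) hpos
          rw [h1] at h2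
          rw [Finset.mem_Ico, Fin.valEmbedding_apply]
          omega
      _ = 2 ^ d := by simp

section Exchange

variable {s d : ℕ} {R : ℕ → ℕ → Bool} {f : ℕ → ℕ} {m : Fin p → Mem α p}

theorem exchange_cost [Nonempty (Fin p)] (hR : IsKernel R f) (hm : HasBlocks s m)
    (hcard : ∀ k : Fin p, (fiber p f (f k)).card ≤ 2 ^ d) :
    (exchange s R).x m ≤ (2 ^ d * d + 1) * s := by
  refine ciSup_le fun k => ?_
  have h1 : ((exchange s R).exec m k).cost =
      ((((List.finRange p).filter fun j : Fin p => R k j).map fun j =>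
        keysOf ((exchange s R).send j (m j) k)).flatten.length : ℝ) *
      lg (((List.finRange p).filter fun j : Fin p => R k j).map fun j =>
        keysOf ((exchange s R).send j (m j) k)).length + s := rfl
  have hg : ((List.finRange p).filter fun j : Fin p => R k j).length = (fiber p f (f k)).card := by
    rw [← List.toFinset_card_of_nodup ((List.nodup_finRange p).filter _)]
    congr 1
    ext j
    simp [hR.iff_symm]
  have hlen : (List.length ∘ fun j : Fin p => (m j).sample) = fun _ => s := funext fun j => (hm j).2
  rw [h1, exchange_group hR, List.length_map, List.length_flatten, List.map_map, hlen, hg,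
    sum_map_filter_finRange, Finset.sum_const, smul_eq_mul]
  have hf : (Finset.univ.filter fun j : Fin p => R k j = true) = fiber p f (f k) := by
    ext j
    simp [hR.iff_symm]
  rw [hf]
  have hpos : 0 < (fiber p f (f k)).card := Finset.card_pos.2 ⟨k, by simp⟩
  have hc1 : (1 : ℝ) ≤ (fiber p f (f k)).card := by exact_mod_cast hpos
  have hc2 : ((fiber p f (f k)).card : ℝ) ≤ 2 ^ d := by exact_mod_cast hcard k
  have hl : lg (fiber p f (f k)).card ≤ d := by
    rw [← lg_two_pow d]
    exact lg_le_lg (by linarith) hc2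
  have h3 : (((fiber p f (f k)).card * s : ℕ) : ℝ) * lg (fiber p f (f k)).card ≤
      (2 ^ d * s) * d := by
    rw [Nat.cast_mul]
    exact mul_le_mul (mul_le_mul_of_nonneg_right hc2 (by positivity)) hl (lg_nonneg hc1)
      (by positivity)
  linarith

theorem exchange_h (hR : IsKernel R f) (hm : HasBlocks s m)
    (hcard : ∀ k : Fin p, (fiber p f (f k)).card ≤ 2 ^ d) :
    (exchange s R).h m ≤ 2 ^ d * s := by
  have h1 : ∀ k j : Fin p, ((exchange s R).send k (m k) j).length =
      if R k j = true then s else 0 := by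
    intro k j
    rw [← (hm k).2]
    by_cases h : R k j = true <;> simp [exchange, h]
  have h2 : ∀ k : Fin p, (Finset.univ.filter fun j : Fin p => R k j = true) = fiber p f (f k) := by
    intro k
    ext j
    simp [hR.iff_symm]
  have h3 : ∀ k j : Fin p, (R j k = true) = (R k j = true) := fun k j => by
    rw [hR.iff_symm, hR]
  refine Superstep.h_le _ _ (fun k => ?_) (fun k => ?_)
  · simp only [h1]
    rw [← Finset.sum_filter, h2, Finset.sum_const, smul_eq_mul]
    exact Nat.mul_le_mul_right _ (hcard k)
  · simp only [h1, h3 k]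
    rw [← Finset.sum_filter, h2, Finset.sum_const, smul_eq_mul]
    exact Nat.mul_le_mul_right _ (hcard k)

theorem compTime_exchange_le [Nonempty (Fin p)] (hm : HasBlocks s m) {l : List (ℕ → ℕ → Bool)}
    (hl : ∀ R ∈ l, ∃ f, IsKernel R f ∧ ∀ k : Fin p, (fiber p f (f k)).card ≤ 2 ^ d) :
    compTime (l.map (exchange s)) m ≤ l.length * ((2 ^ d * d + 1) * s) := by
  induction l generalizing m with
  | nil => simp [compTime]
  | cons R l ih =>
    obtain ⟨f, hf, hcard⟩ := hl R (by simp)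
    have h1 := exchange_cost hf hm hcard
    have h2 := ih (hm.run_exchange hf) fun R' h => hl R' (by simp [h])
    rw [List.map_cons, compTime, List.length_cons, Nat.cast_succ]
    linarith

theorem commTime_exchange_le {L g : ℝ} (hL : 0 ≤ L) (hg : 0 ≤ g) (hm : HasBlocks s m)
    {l : List (ℕ → ℕ → Bool)}
    (hl : ∀ R ∈ l, ∃ f, IsKernel R f ∧ ∀ k : Fin p, (fiber p f (f k)).card ≤ 2 ^ d) :
    commTime L g (l.map (exchange s)) m ≤ l.length * (L + g * (2 ^ d * s : ℕ)) := by
  induction l generalizing m with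
  | nil => simp [commTime]
  | cons R l ih =>
    obtain ⟨f, hf, hcard⟩ := hl R (by simp)
    have h1 := max_le_add hL hg (exchange_h hf hm hcard)
    have h2 := ih (hm.run_exchange hf) fun R' h => hl R' (by simp [h])
    rw [List.map_cons, commTime, List.length_cons, Nat.cast_succ]
    linarith

end Exchange

theorem broadcast_cost [Nonempty (Fin p)] {m : Fin p → Mem α p} {N : ℕ}
    (hN : ∀ k, (m k).keys.length ≤ N) :
    broadcast.x m ≤ p * (Nat.clog 2 (N + 1) + 1) := by
  refine ciSup_le fun k => ?_
  have h1 : (broadcast.exec m k).cost =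
      (∑ i ∈ Finset.Ico 1 p, ((Nat.clog 2 ((m k).keys.length + 1) : ℕ) : ℝ)) + p := rfl
  have h2 : ((Nat.clog 2 ((m k).keys.length + 1) : ℕ) : ℝ) ≤ (Nat.clog 2 (N + 1) : ℕ) := by
    exact_mod_cast Nat.clog_mono_right 2 (Nat.succ_le_succ (hN k))
  have h3 : ((p - 1 : ℕ) : ℝ) ≤ p := by exact_mod_cast Nat.sub_le p 1
  rw [h1, Finset.sum_const, Nat.card_Ico, nsmul_eq_mul]
  have := mul_le_mul h3 h2 (by positivity) (by positivity)
  linarith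

theorem broadcast_h (m : Fin p → Mem α p) : broadcast.h m ≤ p := by
  have h1 : ∀ k j : Fin p, (broadcast.send k (m k) j).length ≤ 1 := by
    intro k j
    unfold broadcast
    dsimp only
    split_ifs
    · cases (m k).sample.getLast? <;> simp
    · simp
  refine Superstep.h_le _ _ (fun k => ?_) (fun k => ?_)
  · exact (Finset.sum_le_sum fun j _ => h1 k j).trans (by simp)
  · exact (Finset.sum_le_sum fun j _ => h1 j k).trans (by simp)

theorem route_send_length_le (m : Fin p → Mem α p) (k i : Fin p) :
    (route.send k (m k) i).length ≤ ((m k).cut (i + 1) - (m k).cut i) + 1 := by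
  simp [route]

theorem route_cost [Nonempty (Fin p)] {m : Fin p → Mem α p} {B : ℕ}
    (hB : ∀ i : Fin p, ∑ k, ((m k).cut (i + 1) - (m k).cut i) ≤ B) :
    route.x m ≤ B * lg p := by
  refine ciSup_le fun i => ?_
  have h1 : (route.exec m i).cost =
      (((List.finRange p).map fun k => keysOf (route.send k (m k) i)).flatten.length : ℝ) *
        lg ((List.finRange p).map fun k => keysOf (route.send k (m k) i)).length := rfl
  have hk : ∀ k, (keysOf (route.send k (m k) i)).length ≤ (m k).cut (i + 1) - (m k).cut i := by
    intro k
    have : keysOf (route.send k (m k) i) =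
        keysOf ((((m k).keys.drop ((m k).cut i)).take ((m k).cut (i + 1) - (m k).cut i)).map
          (Sum.inl : _ → Word α)) := rfl
    rw [this, keysOf_map_inl]
    exact List.length_take_le _ _
  rw [h1, List.length_flatten, List.map_map, List.length_map, List.length_finRange]
  have h2 : ((List.finRange p).map
      (List.length ∘ fun k => keysOf (route.send k (m k) i))).sum ≤ B := by
    rw [← List.sum_toFinset _ (List.nodup_finRange p), List.toFinset_finRange]
    exact (Finset.sum_le_sum fun k _ => hk k).trans (hB i)
  have hp : 1 ≤ p := Fin.pos i
  exact mul_le_mul_of_nonneg_right (by exact_mod_cast h2) (lg_nonneg (by exact_mod_cast hp))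

theorem route_h {m : Fin p → Mem α p} {B : ℕ}
    (hB : ∀ i : Fin p, ∑ k, ((m k).cut (i + 1) - (m k).cut i) ≤ B)
    (hB' : ∀ k : Fin p, ∑ i : Fin p, ((m k).cut (i + 1) - (m k).cut i) ≤ B) :
    route.h m ≤ B + p := by
  refine Superstep.h_le _ _ (fun k => ?_) (fun k => ?_)
  · refine (Finset.sum_le_sum fun j _ => route_send_length_le m k j).trans ?_
    rw [Finset.sum_add_distrib]
    have := hB' k
    simp
    omega
  · refine (Finset.sum_le_sum fun j _ => route_send_length_le m j k).trans ?_
    rw [Finset.sum_add_distrib]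
    have := hB k
    simp
    omega

end Costs

/-! ### Cost of the algorithm -/

section Total

/-- The number of supersteps of the network. -/
theorem two_mul_length_bitonicRounds (d q : ℕ) :
    2 * (bitonicRounds d q).length = 2 + (Nat.clog 2 q - d) * (Nat.clog 2 q - d + 3) := by
  have h : ∀ t, 2 * ((List.range' (d + 1) t).flatMap (mergeRounds d)).length = t * (t + 3) := by
    intro t
    induction t with
    | zero => simp
    | succ t ih =>
      rw [List.range'_1_concat, List.flatMap_append, List.length_append, mul_add, ih,
        List.flatMap_singleton]
      have : (mergeRounds d (d + 1 + t)).length = t + 2 := by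
        simp [mergeRounds]
      rw [this]
      ring
  rw [bitonicRounds_eq, List.length_cons, mul_add, h]
  ring

variable {α : Type*} [LinearOrder α] {d n p s x : ℕ} {X : Fin p → List α}

/-- An upper bound for the number of keys at a processor after the routing, namely
`s x + (p - 1) (x - 1)`, for sample size `s` and segments of `x` keys. It is written with a single
truncated subtraction, which is exact for `p, x ≥ 1`. -/
def bucketBound (p s x : ℕ) : ℕ := s * x + p * x + 1 - (p + x)

/-- The total time of the supersteps, for sample size `s` and segments of `x` keys. -/
theorem IsInput.cost_le (hX : IsInput n X) (hd : 1 ≤ d) (hp : 2 ≤ p) (hs : 0 < s) (hx : 0 < x)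
    (hlen : n ⌈/⌉ p ≤ s * x) {L g : ℝ} (hL : 0 ≤ L) (hg : 0 ≤ g) :
    compTime ([localSort s x] ++ (bitonicRounds d p).map (exchange s) ++
      [broadcast, prefixSums, addresses, route]) (initialMem X) ≤
      ((n ⌈/⌉ p : ℕ) * lg (n ⌈/⌉ p : ℕ) + 2 * s) +
        (bitonicRounds d p).length * ((2 ^ d * d + 1) * s) +
        p * (Nat.clog 2 (n ⌈/⌉ p + 1) + 1) + 2 * p + bucketBound p s x * lg p ∧
    commTime L g ([localSort s x] ++ (bitonicRounds d p).map (exchange s) ++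
      [broadcast, prefixSums, addresses, route]) (initialMem X) ≤
      (bitonicRounds d p).length * (L + g * (2 ^ d * s : ℕ)) + 5 * L +
        g * (bucketBound p s x + 4 * p) := by
  have : Nonempty (Fin p) := ⟨⟨0, by omega⟩⟩
  have hsample := hX.isSortedSample (d := d) hs hx hlen
  have hcut := isCut_broadcast hs hp hsample
  have hb := hasBlocks_localSort s x X
  have hrounds := fun (R : ℕ → ℕ → Bool) (hR : R ∈ bitonicRounds d p) => card_group_le (p := p) hd hR
  have hpx := add_le_mul_add_one hx hp
  have hN : ∀ k, (sortedMem d s x X k).keys.length ≤ n ⌈/⌉ p := fun k => by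
    rw [sortedMem, keys_runAll, keys_localSort, List.length_mergeSort, List.length_map]
    exact hX.even k
  have hB : ∀ i : Fin p, ∑ k, ((broadcast.run (sortedMem d s x X) k).cut (i + 1) -
      (broadcast.run (sortedMem d s x X) k).cut i) ≤ bucketBound p s x := fun i => by
    have := hcut.bucket_le hsample hs hx hp i.isLt
    unfold bucketBound
    omega
  have hB' : ∀ k : Fin p, ∑ i : Fin p, ((broadcast.run (sortedMem d s x X) k).cut (i + 1) -
      (broadcast.run (sortedMem d s x X) k).cut i) ≤ bucketBound p s x := fun k => by
    rw [hcut.sum_sub hsample hs k]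
    have := hsample.keys_length k
    unfold bucketBound
    omega
  constructor
  · rw [compTime_append, compTime_append, runAll_append]
    have h1 := localSort_cost hX s x
    have h2 := compTime_exchange_le hb hrounds
    have h3 := broadcast_cost hN
    have h4 := prefixSums_cost (broadcast.run (sortedMem d s x X))
    have h5 := addresses_cost (prefixSums.run (broadcast.run (sortedMem d s x X)))
    have h6 := route_cost
      (m := addresses.run (prefixSums.run (broadcast.run (sortedMem d s x X)))) hB
    simp only [compTime, runAll_cons, runAll_nil, add_zero]
    rw [← sortedMem]
    linarith
  · rw [commTime_append, commTime_append, runAll_append]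
    have h1 := max_le_add hL hg (localSort_h (X := X) s x)
    have h2 := commTime_exchange_le hL hg hb hrounds
    have h3 := max_le_add hL hg (broadcast_h (sortedMem d s x X))
    have h4 := max_le_add hL hg (prefixSums_h (broadcast.run (sortedMem d s x X)))
    have h5 := max_le_add hL hg
      (addresses_h (prefixSums.run (broadcast.run (sortedMem d s x X))))
    have h6 := max_le_add hL hg (route_h
      (m := addresses.run (prefixSums.run (broadcast.run (sortedMem d s x X)))) hB hB')
    simp only [commTime, runAll_cons, runAll_nil, add_zero]
    rw [← sortedMem]
    push_cast at h1 h6 ⊢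
    push_cast at h2
    linarith

end Total

/-! ### Estimates -/

section Estimates

theorem ceilDiv_le (a b : ℕ) (hb : 0 < b) : ((a ⌈/⌉ b : ℕ) : ℝ) ≤ (a + b - 1) / b := by
  rw [Nat.ceilDiv_eq_add_pred_div]
  refine Nat.cast_div_le.trans (le_of_eq ?_)
  rw [Nat.cast_sub (by omega)]
  push_cast
  ring

theorem ceilDiv_le_div_add_one (a b : ℕ) (hb : 0 < b) : ((a ⌈/⌉ b : ℕ) : ℝ) ≤ a / b + 1 := by
  have hb' : (0 : ℝ) < b := by exact_mod_cast hb
  refine (ceilDiv_le a b hb).trans ?_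
  rw [div_add_one hb'.ne']
  exact div_le_div_of_nonneg_right (by linarith) hb'.le

/-- The bound on the bucket sizes leaves a slack of `(n / p) / s` below `nMax`. This slack pays for
the binary searches and for the rounding in the local sorting when `n` is large. -/
theorem bucketBound_le {n p : ℕ} {ω : ℝ} (hp : 2 ≤ p) (hr : 0 < ⌈ω⌉₊)
    (hx : 0 < (n ⌈/⌉ p) ⌈/⌉ (⌈ω⌉₊ * p)) :
    (bucketBound p (⌈ω⌉₊ * p) ((n ⌈/⌉ p) ⌈/⌉ (⌈ω⌉₊ * p)) : ℝ) ≤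
      nMax n p ω - (n / p : ℝ) / (⌈ω⌉₊ * p) := by
  have hs : 0 < ⌈ω⌉₊ * p := by positivity
  have h1 := ceilDiv_le (n ⌈/⌉ p) (⌈ω⌉₊ * p) hs
  have h3 := ceilDiv_le_div_add_one n p (by omega)
  have hpx := add_le_mul_add_one hx hp
  unfold bucketBound nMax
  generalize (n ⌈/⌉ p) ⌈/⌉ (⌈ω⌉₊ * p) = x at *
  generalize n ⌈/⌉ p = N at *
  rw [Nat.cast_sub (by omega)]
  push_cast at h1 ⊢
  have hp' : (2 : ℝ) ≤ p := by exact_mod_cast hp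
  have hr' : (1 : ℝ) ≤ ⌈ω⌉₊ := by exact_mod_cast hr
  generalize (⌈ω⌉₊ : ℝ) = r at *
  have h4 : (x : ℝ) ≤ (n / p) / (r * p) + 1 := by
    refine h1.trans ?_
    rw [div_add_one (by positivity)]
    exact div_le_div_of_nonneg_right (by linarith) (by positivity)
  have h5 : (r * p + p - 1) * (x : ℝ) ≤ (r * p + p - 1) * ((n / p) / (r * p) + 1) :=
    mul_le_mul_of_nonneg_left h4 (by nlinarith)
  have h6 : (r * p + p - 1) * ((n / p : ℝ) / (r * p) + 1) =
      (1 + 1 / r) * (n / p) + r * p + p - 1 - (n / p : ℝ) / (r * p) := by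
    field_simp
    ring
  linarith

theorem clog_le_lg_add_one {a : ℕ} (ha : 1 ≤ a) : (Nat.clog 2 a : ℝ) ≤ lg a + 1 := by
  rcases Nat.eq_or_lt_of_le ha with rfl | ha
  · simp [lg]
  · have h1 := Nat.pow_pred_clog_lt_self one_lt_two ha
    have h2 : 0 < Nat.clog 2 a := Nat.clog_pos one_lt_two ha
    have h3 : lg ((2 : ℝ) ^ (Nat.clog 2 a - 1)) ≤ lg a :=
      lg_le_lg (by positivity) (by exact_mod_cast h1.le)
    rw [lg_two_pow, Nat.cast_sub h2] at h3
    push_cast at h3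
    linarith

theorem one_le_lg {a : ℝ} (ha : 2 ≤ a) : 1 ≤ lg a := by
  have := lg_le_lg two_pos ha
  rwa [lg, Real.logb_self_eq_one one_lt_two] at this

/-- Sorting `⌈n / p⌉` instead of `n / p` keys costs only `O(lg n)` more. -/
theorem ceilDiv_mul_lg_le {n p : ℕ} (hp : 2 ≤ p) (hpn : p ≤ n) :
    ((n ⌈/⌉ p : ℕ) : ℝ) * lg (n ⌈/⌉ p : ℕ) ≤ (n / p : ℝ) * lg (n / p) + lg n + 2 := by
  have hp' : (2 : ℝ) ≤ p := by exact_mod_cast hp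
  have hpn' : (p : ℝ) ≤ n := by exact_mod_cast hpn
  have h3 := ceilDiv_le_div_add_one n p (by omega)
  have hN : 1 ≤ n ⌈/⌉ p := by
    rw [Nat.ceilDiv_eq_add_pred_div]
    exact (Nat.one_le_div_iff (by omega)).2 (by omega)
  have hN' : (1 : ℝ) ≤ (n ⌈/⌉ p : ℕ) := by exact_mod_cast hN
  generalize ((n ⌈/⌉ p : ℕ) : ℝ) = N at *
  have hy1 : (1 : ℝ) ≤ n / p := (one_le_div (by linarith)).2 hpn'
  have hy2 : (n / p : ℝ) + 1 ≤ n := by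
    have : (n / p : ℝ) ≤ n / 2 := div_le_div_of_nonneg_left (by linarith) two_pos hp'
    linarith
  generalize (n / p : ℝ) = y at *
  have h4 : N * lg N ≤ (y + 1) * lg (y + 1) :=
    mul_le_mul h3 (lg_le_lg (by linarith) h3) (lg_nonneg hN') (by linarith)
  have h5 : lg (y + 1) ≤ lg n := lg_le_lg (by linarith) hy2
  have h6 : y * lg (y + 1) ≤ y * lg y + 2 := by
    have h7 : Real.log (y + 1) - Real.log y ≤ 1 / y := by
      rw [← Real.log_div (by linarith) (by linarith)]
      refine (Real.log_le_sub_one_of_pos (by positivity)).trans (le_of_eq ?_)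
      field_simp
      ring
    have h8 : (1 : ℝ) / 2 ≤ Real.log 2 := by linarith [Real.log_two_gt_d9]
    have h9 : y * (Real.log (y + 1) - Real.log y) ≤ 1 := by
      calc y * (Real.log (y + 1) - Real.log y) ≤ y * (1 / y) :=
            mul_le_mul_of_nonneg_left h7 (by linarith)
        _ = 1 := by field_simp
    have h10 : y * lg (y + 1) - y * lg y =
        y * (Real.log (y + 1) - Real.log y) / Real.log 2 := by
      simp only [lg, Real.logb]
      ring
    have h11 : y * (Real.log (y + 1) - Real.log y) / Real.log 2 ≤ 2 := by
      rw [div_le_iff₀ (by linarith)]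
      linarith
    linarith
  linarith

theorem clog_ceilDiv_le {n p : ℕ} (hp : 2 ≤ p) (hpn : p ≤ n) :
    (Nat.clog 2 (n ⌈/⌉ p + 1) : ℝ) ≤ lg n + 2 := by
  have hle : n ⌈/⌉ p ≤ n := by
    rw [Nat.ceilDiv_eq_add_pred_div]
    have := add_le_mul_add_one (show 0 < n by omega) hp
    exact Nat.div_le_of_le_mul (by omega)
  have h1 := clog_le_lg_add_one (show 1 ≤ n ⌈/⌉ p + 1 by omega)
  have hn : (0 : ℝ) < n := by exact_mod_cast (show 0 < n by omega)
  have h2 : lg ((n ⌈/⌉ p + 1 : ℕ) : ℝ) ≤ lg (2 * n) := by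
    refine lg_le_lg (by positivity) ?_
    exact_mod_cast (show n ⌈/⌉ p + 1 ≤ 2 * n by omega)
  have h3 : lg (2 * n) = 1 + lg n := by
    rw [lg, Real.logb_mul two_ne_zero hn.ne', Real.logb_self_eq_one one_lt_two, lg]
  linarith

theorem exists_sq_lg_le (A : ℝ) : ∃ n₀ : ℝ, ∀ y, n₀ ≤ y → (A * lg y ^ 2) ^ 2 ≤ y := by
  have h := (Real.isLittleO_pow_log_id_atTop (n := 4)).bound
    (show 0 < 1 / ((A / Real.log 2 ^ 2) ^ 2 + 1) by positivity)
  obtain ⟨a, ha⟩ := Filter.eventually_atTop.1 h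
  refine ⟨max a 0, fun y hy => ?_⟩
  have h1 := ha y ((le_max_left _ _).trans hy)
  have hy0 : 0 ≤ y := (le_max_right _ _).trans hy
  rw [Real.norm_of_nonneg (by positivity), id, Real.norm_of_nonneg hy0, one_div,
    ← div_eq_inv_mul, le_div_iff₀ (by positivity)] at h1
  have h2 : (A * lg y ^ 2) ^ 2 = Real.log y ^ 4 * (A / Real.log 2 ^ 2) ^ 2 := by
    simp only [lg, Real.logb]
    ring
  have h3 : 0 ≤ Real.log y ^ 4 := by positivity
  rw [h2]
  linarith

/-- The cost of the binary searches is covered by the slack in the bucket sizes if `n` is large in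
comparison with `p`, and otherwise by the cost of sorting the sample. -/
theorem exists_search_le {c₁ c₂ : ℝ} (hc₁ : 0 < c₁) :
    ∃ C : ℝ, 0 ≤ C ∧ ∀ (n p : ℕ) (ω : ℝ), 2 ≤ p → p ≤ n → c₁ ≤ ω → ω ≤ c₂ * lg n →
      2 * p * lg n ≤ (n / p : ℝ) / (⌈ω⌉₊ * p) * lg p + C * (p + ω * p * lg p ^ 2) := by
  obtain ⟨n₀, hn₀⟩ := exists_sq_lg_le (2 * ((1 + 1 / c₁) * c₂))
  refine ⟨max (12 / c₁) (2 * lg (max n₀ 1)), ?_, fun n p ω hp hpn hω₁ hω₂ => ?_⟩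
  · exact (by positivity : 0 ≤ 12 / c₁).trans (le_max_left _ _)
  have hp' : (2 : ℝ) ≤ p := by exact_mod_cast hp
  have hpn' : (p : ℝ) ≤ n := by exact_mod_cast hpn
  have hℓ := one_le_lg hp'
  have hω : 0 < ω := hc₁.trans_le hω₁
  have hr : (1 : ℝ) ≤ ⌈ω⌉₊ := by exact_mod_cast Nat.ceil_pos.2 hω
  have hrω : (⌈ω⌉₊ : ℝ) ≤ (1 + 1 / c₁) * ω := by
    have h1 := (Nat.ceil_lt_add_one hω.le).le
    have h2 : 1 ≤ 1 / c₁ * ω := by rwa [one_div_mul_eq_div, one_le_div hc₁]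
    linarith
  have hslack : 0 ≤ (n / p : ℝ) / (⌈ω⌉₊ * p) * lg p := by positivity
  have hterm : 0 ≤ ω * p * lg p ^ 2 := by positivity
  have hlgn : 1 ≤ lg n := one_le_lg (hp'.trans hpn')
  rcases le_or_gt (lg n) (6 * lg p) with hcase | hcase
  · have h1 : 2 * p * lg n ≤ 12 / c₁ * (ω * p * lg p ^ 2) := by
      have h2 : 1 ≤ ω / c₁ := (one_le_div hc₁).2 hω₁
      have h3 : lg n ≤ 6 * (ω / c₁) * lg p ^ 2 := by
        have : lg p ≤ lg p ^ 2 := by nlinarith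
        have : lg p ^ 2 ≤ ω / c₁ * lg p ^ 2 := le_mul_of_one_le_left (by positivity) h2
        linarith
      calc 2 * p * lg n ≤ 2 * p * (6 * (ω / c₁) * lg p ^ 2) :=
            mul_le_mul_of_nonneg_left h3 (by positivity)
        _ = _ := by ring
    have h2 : 12 / c₁ * (ω * p * lg p ^ 2) ≤
        max (12 / c₁) (2 * lg (max n₀ 1)) * (p + ω * p * lg p ^ 2) :=
      mul_le_mul (le_max_left _ _) (by linarith) hterm
        ((by positivity : 0 ≤ 12 / c₁).trans (le_max_left _ _))
    linarith
  · rcases le_or_gt n₀ n with hn | hn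
    · have h1 : (p : ℝ) ^ 6 ≤ n := by
        have h2 : lg ((p : ℝ) ^ 6) < lg n := by
          rw [lg, Real.logb_pow]
          exact_mod_cast hcase
        exact ((Real.logb_lt_logb_iff one_lt_two (by positivity) (by linarith)).1 h2).le
      have h3 := hn₀ n hn
      have h4 : 2 * p * lg n * (⌈ω⌉₊ * p * p) ≤ n := by
        have h5 : (⌈ω⌉₊ : ℝ) ≤ (1 + 1 / c₁) * (c₂ * lg n) :=
          hrω.trans (mul_le_mul_of_nonneg_left hω₂ (by positivity))
        calc 2 * p * lg n * (⌈ω⌉₊ * p * p) = 2 * p ^ 3 * lg n * ⌈ω⌉₊ := by ring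
          _ ≤ 2 * p ^ 3 * lg n * ((1 + 1 / c₁) * (c₂ * lg n)) :=
            mul_le_mul_of_nonneg_left h5 (by positivity)
          _ = p ^ 3 * (2 * ((1 + 1 / c₁) * c₂) * lg n ^ 2) := by ring
          -- both factors have squares at most `n`
          _ ≤ n := by nlinarith [sq_nonneg ((p : ℝ) ^ 3 - 2 * ((1 + 1 / c₁) * c₂) * lg n ^ 2)]
      have h5 : 2 * p * lg n ≤ (n / p : ℝ) / (⌈ω⌉₊ * p) := by
        rw [le_div_iff₀ (by positivity), le_div_iff₀ (by positivity)]
        linarith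
      have h6 : (n / p : ℝ) / (⌈ω⌉₊ * p) ≤ (n / p : ℝ) / (⌈ω⌉₊ * p) * lg p :=
        le_mul_of_one_le_right (by positivity) hℓ
      have h7 : 0 ≤ max (12 / c₁) (2 * lg (max n₀ 1)) :=
        (by positivity : 0 ≤ 12 / c₁).trans (le_max_left _ _)
      have h8 : 0 ≤ max (12 / c₁) (2 * lg (max n₀ 1)) * (p + ω * p * lg p ^ 2) := by positivity
      linarith
    · have h1 : lg n ≤ lg (max n₀ 1) := lg_le_lg (by linarith) (hn.le.trans (le_max_left _ _))
      have h2 : 2 * lg (max n₀ 1) * p ≤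
          max (12 / c₁) (2 * lg (max n₀ 1)) * (p + ω * p * lg p ^ 2) :=
        mul_le_mul (le_max_right _ _) (by linarith) (by positivity)
          ((by positivity : 0 ≤ 12 / c₁).trans (le_max_left _ _))
      nlinarith

theorem length_bitonicRounds_le {d p : ℕ} (hd : 1 ≤ d) (hp : 2 ≤ p) :
    ((bitonicRounds d p).length : ℝ) ≤ 3 * lg p ^ 2 := by
  have hℓ : 1 ≤ lg p := one_le_lg (by exact_mod_cast hp)
  have h1 := two_mul_length_bitonicRounds d p
  have hK := clog_le_lg_add_one (show 1 ≤ p by omega)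
  have hK1 : 1 ≤ Nat.clog 2 p := Nat.clog_pos one_lt_two hp
  have h2 : 2 * (bitonicRounds d p).length ≤ 2 + (Nat.clog 2 p - 1) * (Nat.clog 2 p + 2) := by
    rw [h1]
    exact Nat.add_le_add_left (Nat.mul_le_mul (by omega) (by omega)) 2
  have h3 : 2 * ((bitonicRounds d p).length : ℝ) ≤
      2 + ((Nat.clog 2 p : ℝ) - 1) * (Nat.clog 2 p + 2) := by
    have := (Nat.cast_le (α := ℝ)).2 h2
    push_cast [Nat.cast_sub hK1] at this
    exact this
  have h4 : ((Nat.clog 2 p : ℝ) - 1) * (Nat.clog 2 p + 2) ≤ lg p * (lg p + 3) :=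
    mul_le_mul (by linarith) (by linarith) (by positivity) (by linarith)
  nlinarith

theorem length_bitonicRounds_le_of_three_le {d p : ℕ} (hd : 3 ≤ d) (hp : 2 ≤ p) :
    ((bitonicRounds d p).length : ℝ) ≤ lg p ^ 2 / 2 + 1 := by
  have h1 := two_mul_length_bitonicRounds d p
  have hK := clog_le_lg_add_one (show 1 ≤ p by omega)
  have h2 : (2 * (bitonicRounds d p).length : ℝ) =
      2 + ((Nat.clog 2 p - d : ℕ) : ℝ) * ((Nat.clog 2 p - d : ℕ) + 3) := by exact_mod_cast h1
  rcases le_total (Nat.clog 2 p) d with h | h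
  · rw [Nat.sub_eq_zero_of_le h] at h2
    push_cast at h2
    nlinarith [sq_nonneg (lg p)]
  · rw [Nat.cast_sub h] at h2
    have hd' : (3 : ℝ) ≤ d := by exact_mod_cast hd
    have h' : (d : ℝ) ≤ Nat.clog 2 p := by exact_mod_cast h
    have h3 : ((Nat.clog 2 p : ℝ) - d) * (Nat.clog 2 p - d + 3) ≤ (lg p - 2) * (lg p + 1) :=
      mul_le_mul (by linarith) (by linarith) (by linarith) (by linarith)
    nlinarith

theorem length_bitonicRounds_one {p : ℕ} (hp : 2 ≤ p) :
    ((bitonicRounds 1 p).length : ℝ) = ((Nat.clog 2 p : ℝ) ^ 2 + Nat.clog 2 p) / 2 := by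
  have h1 := two_mul_length_bitonicRounds 1 p
  have hK1 : 1 ≤ Nat.clog 2 p := Nat.clog_pos one_lt_two hp
  have h2 := congrArg (Nat.cast (R := ℝ)) h1
  push_cast [Nat.cast_sub hK1] at h2
  linarith

end Estimates

end BSP

theorem proposition1 (d : ℕ) (hd : 1 ≤ d) (c₁ c₂ : ℝ) (hc₁ : 0 < c₁) (hc₂ : 0 < c₂) :
    ∃ C : ℝ, ∀ (n p : ℕ) (ω : ℝ), 2 ≤ p → p ≤ n →
      c₁ ≤ ω → ω ≤ c₂ * BSP.lg n → (p : ℝ) ^ 2 * ω ^ 2 ≤ n / BSP.lg n →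
      ∀ (L g : ℝ), 0 ≤ L → 0 ≤ g →
      ∀ (α : Type*) [LinearOrder α] (X : Fin p → List α), BSP.IsInput n X →
        BSP.compTime (BSP.sortDetBSP α d n p ω) (BSP.initialMem X)
            ≤ (n / p : ℝ) * BSP.lg (n / p) + BSP.nMax n p ω * BSP.lg p
              + C * (p + ω * p * BSP.lg p ^ 2) ∧
        (3 ≤ d →
          BSP.commTime L g (BSP.sortDetBSP α d n p ω) (BSP.initialMem X)
            ≤ g * BSP.nMax n p ω + L * BSP.lg p ^ 2 / 2
              + C * (L + g * ω * p * BSP.lg p ^ 2)) ∧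
        (d = 1 →
          BSP.commTime L g (BSP.sortDetBSP α d n p ω) (BSP.initialMem X)
            ≤ g * BSP.nMax n p ω + L * ((Nat.clog 2 p : ℝ) ^ 2 + Nat.clog 2 p) / 2
              + C * (L + g * ω * p * BSP.lg p ^ 2)) := by
  obtain ⟨C₁, hC₁, hsearch⟩ := BSP.exists_search_le (c₂ := c₂) hc₁
  -- `κ ω` bounds both `1` and `⌈ω⌉`
  obtain ⟨κ, hκ⟩ : ∃ κ, κ = 1 + 1 / c₁ := ⟨_, rfl⟩
  have hκ0 : 0 ≤ κ := by rw [hκ]; positivity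
  refine ⟨C₁ + (2 + 3 * (2 ^ d * d + 1)) * κ + 3 * 2 ^ d * κ + 4 * κ + 6, ?_⟩
  intro n p ω hp hpn hω₁ hω₂ _ L g hL hg α _ X hX
  have hp' : (2 : ℝ) ≤ p := by exact_mod_cast hp
  have hℓ := BSP.one_le_lg hp'
  have hω : 0 < ω := hc₁.trans_le hω₁
  have hr : 0 < ⌈ω⌉₊ := Nat.ceil_pos.2 hω
  have h1κ : 1 ≤ κ * ω := by
    have : 1 ≤ 1 / c₁ * ω := by rwa [one_div_mul_eq_div, one_le_div hc₁]
    rw [hκ]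
    linarith
  have hrκ : (⌈ω⌉₊ : ℝ) ≤ κ * ω := by
    have h1 := (Nat.ceil_lt_add_one hω.le).le
    have h2 : 1 ≤ 1 / c₁ * ω := by rwa [one_div_mul_eq_div, one_le_div hc₁]
    rw [hκ]
    linarith
  have hs : 0 < ⌈ω⌉₊ * p := by positivity
  have hN : 0 < n ⌈/⌉ p := by
    rw [Nat.ceilDiv_eq_add_pred_div]
    exact Nat.div_pos (by omega) (by omega)
  have hx : 0 < (n ⌈/⌉ p) ⌈/⌉ (⌈ω⌉₊ * p) := by
    rw [Nat.ceilDiv_eq_add_pred_div]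
    exact Nat.div_pos (by omega) hs
  have hlen : n ⌈/⌉ p ≤ ⌈ω⌉₊ * p * ((n ⌈/⌉ p) ⌈/⌉ (⌈ω⌉₊ * p)) := by
    simpa using le_smul_ceilDiv (b := n ⌈/⌉ p) hs
  have hbucket := BSP.bucketBound_le (n := n) hp hr hx
  have hsort := BSP.ceilDiv_mul_lg_le hp hpn
  have hclog := BSP.clog_ceilDiv_le hp hpn
  have hse := hsearch n p ω hp hpn hω₁ hω₂
  have hrounds := BSP.length_bitonicRounds_le hd hp
  obtain ⟨hcomp, hcomm⟩ := hX.cost_le hd hp hs hx hlen hL hg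
  -- all lower-order terms are multiples of `ω p lg² p`
  obtain ⟨Q, hQ⟩ : ∃ Q, Q = ω * p * BSP.lg p ^ 2 := ⟨_, rfl⟩
  have hℓ2 : 1 ≤ BSP.lg p ^ 2 := one_le_pow₀ hℓ
  have hQ0 : 0 ≤ Q := by rw [hQ]; positivity
  have hpQ : (p : ℝ) ≤ κ * Q := by
    calc (p : ℝ) = 1 * p * 1 := by ring
      _ ≤ (κ * ω) * p * BSP.lg p ^ 2 := by gcongr
      _ = κ * Q := by rw [hQ]; ring
  have hsℓ : (⌈ω⌉₊ * p : ℝ) * BSP.lg p ^ 2 ≤ κ * Q := by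
    calc (⌈ω⌉₊ * p : ℝ) * BSP.lg p ^ 2 ≤ (κ * ω) * p * BSP.lg p ^ 2 := by gcongr
      _ = κ * Q := by rw [hQ]; ring
  have hsQ : (⌈ω⌉₊ * p : ℝ) ≤ κ * Q := by
    refine le_trans ?_ hsℓ
    exact le_mul_of_one_le_right (by positivity) hℓ2
  have hround : ((BSP.bitonicRounds d p).length : ℝ) * (⌈ω⌉₊ * p) ≤ 3 * (κ * Q) := by
    calc ((BSP.bitonicRounds d p).length : ℝ) * (⌈ω⌉₊ * p)
        ≤ 3 * BSP.lg p ^ 2 * (⌈ω⌉₊ * p) := by gcongr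
      _ = 3 * ((⌈ω⌉₊ * p : ℝ) * BSP.lg p ^ 2) := by ring
      _ ≤ _ := by gcongr
  have hkQ : 0 ≤ κ * Q := by positivity
  have hcomm' : BSP.commTime L g (BSP.sortDetBSP α d n p ω) (BSP.initialMem X) ≤
      g * BSP.nMax n p ω + (BSP.bitonicRounds d p).length * L + 5 * L +
        g * ((3 * 2 ^ d * κ + 4 * κ) * Q) := by
    refine hcomm.trans ?_
    have h1 : (2 ^ d : ℝ) * (((BSP.bitonicRounds d p).length : ℝ) * (⌈ω⌉₊ * p)) ≤
        2 ^ d * (3 * (κ * Q)) := by gcongr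
    have h2 : 0 ≤ (n / p : ℝ) / (⌈ω⌉₊ * p) := by positivity
    have h3 : g * ((2 ^ d : ℝ) * (((BSP.bitonicRounds d p).length : ℝ) * (⌈ω⌉₊ * p)) +
        (BSP.bucketBound p (⌈ω⌉₊ * p) ((n ⌈/⌉ p) ⌈/⌉ (⌈ω⌉₊ * p)) + 4 * p)) ≤
        g * (2 ^ d * (3 * (κ * Q)) + (BSP.nMax n p ω + 4 * (κ * Q))) := by
      gcongr
      linarith
    push_cast
    linarith
  have hcommC : 5 * L + g * ((3 * 2 ^ d * κ + 4 * κ) * Q) + L ≤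
      (C₁ + (2 + 3 * (2 ^ d * d + 1)) * κ + 3 * 2 ^ d * κ + 4 * κ + 6) *
        (L + g * ω * p * BSP.lg p ^ 2) := by
    have h1 : g * ω * p * BSP.lg p ^ 2 = g * Q := by rw [hQ]; ring
    rw [h1]
    have h2 : 0 ≤ g * Q := by positivity
    have h3 : 0 ≤ (C₁ + (2 + 3 * (2 ^ d * d + 1)) * κ + 6) * (g * Q) := by positivity
    have h4 : 0 ≤ (C₁ + (2 + 3 * (2 ^ d * d + 1)) * κ + 3 * 2 ^ d * κ + 4 * κ) * L := by positivity
    linarith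
  refine ⟨?_, fun hd3 => ?_, fun hd1 => ?_⟩
  · refine hcomp.trans ?_
    have h1 : (2 ^ d * d + 1 : ℝ) * (((BSP.bitonicRounds d p).length : ℝ) * (⌈ω⌉₊ * p)) ≤
        (2 ^ d * d + 1) * (3 * (κ * Q)) := by gcongr
    have h2 : (BSP.bucketBound p (⌈ω⌉₊ * p) ((n ⌈/⌉ p) ⌈/⌉ (⌈ω⌉₊ * p)) : ℝ) * BSP.lg p ≤
        (BSP.nMax n p ω - (n / p : ℝ) / (⌈ω⌉₊ * p)) * BSP.lg p := by gcongr
    have h3 : (p : ℝ) * (Nat.clog 2 (n ⌈/⌉ p + 1) + 1) ≤ p * (BSP.lg n + 3) :=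
      mul_le_mul_of_nonneg_left (by linarith) (by linarith)
    have hlgn : 0 ≤ BSP.lg n := BSP.lg_nonneg (by exact_mod_cast (show 1 ≤ n by omega))
    have h4 : BSP.lg n ≤ p * BSP.lg n := le_mul_of_one_le_left hlgn (by linarith)
    have h5 : 0 ≤ (2 + 3 * (2 ^ d * d + 1)) * κ * p := by positivity
    have h6 : 0 ≤ (3 * 2 ^ d * κ + 4 * κ) * (p + Q) := by positivity
    rw [← hQ] at hse ⊢
    push_cast
    linarith
  · have := BSP.length_bitonicRounds_le_of_three_le hd3 hp
    have h1 := mul_le_mul_of_nonneg_right this hL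
    linarith
  · have : ((BSP.bitonicRounds d p).length : ℝ) =
        ((Nat.clog 2 p : ℝ) ^ 2 + Nat.clog 2 p) / 2 := by
      rw [hd1]
      exact BSP.length_bitonicRounds_one hp
    rw [this] at hcomm'
    linarith
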